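/- Let $\Omega=\mathbb{CP}^1\times\mathbb{CP}^1/\{([1,0],[t_1,t_2])\sim([t_1,t_2],[0,1])\}$, and fix $B,\Lambda,\tilde c_1,\tilde c_2\in\mathbb C^*$. A bilinear form means $\alpha z_1w_1+\beta z_1w_2+\gamma z_2w_1+\delta z_2w_2$ with $\alpha,\beta,\gamma,\delta\in\mathbb C$, regarded as a function of $P=(z_1,z_2,w_1,w_2)$. Let $g$ be a bilinear form with $g(0,1,0,1)\ne 0$ and $g(1,0,t_1,t_2)=B\,g(t_1,t_2,0,1)$ for all $t$. For $i=1,2$ let $G_i(P,s)$, $s\in\mathbb C$, be bilinear forms in $P$ with $G_i(1,0,t_1,t_2,s)=Be^{s}G_i(t_1,t_2,0,1,s)$ for all $t$ and $s$, with $G_i(P,0)=g(P)$, with coefficients holomorphic in $s$ near $0$, and such that $g,\ \partial_sG_1(\cdot,0),\ \partial_sG_2(\cdot,0)$ are linearly independent. For $h=(h_1,h_2)\in(\mathbb C^*)^2$ put $g_i(P)=G_i(P,\tilde c_ih_i)$, so that $g_i(1,0,t)=c_ig_i(t,0,1)$ with $c_i=Be^{\tilde c_ih_i}$; only those $h$ are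 considered for which $g_i(0,1,0,1)\neq0$ for $i=1,2$. Let $\mathcal K$ be the field of rational functions (over $\mathbb C$) of $e^{\tilde c_1x_1+\tilde c_2x_2}$; for $f\in\mathcal K$ and $n\in\mathbb Z^2$ let $\hat f(n)=f(x_1+n_1h_1,x_2+n_2h_2)$, and let $\hat{\mathcal K}=\{\hat f: f\in\mathcal K\}$. Let $\mathcal T_2=\hat{\mathcal K}[T_1,T_2]$ be the ring of difference operators generated by the multiplications by elements of $\hat{\mathcal K}$ and the shifts $T_i:\psi(n)\mapsto\psi(n+e_i)$, acting on functions of $n\in\mathbb Z^2$ whose values are rational functions of $P$ over $\mathcal K$. Let $\hat M_{\Omega,\Lambda}=\bigcup_{k\ge0}\hat M_{\Omega,\Lambda}(k)$ be the $\mathcal T_2$-module in which $\hat M_{\Omega,\Lambda}(k)$ consists of the functions $$\varphi(n,P)=\frac{\tilde h(n,P)}{g(P)^k}\prod_{j=1}^2\Big(\frac{g_j(P)}{g(P)}\Big)^{n_j},$$ with $\tilde h$ a bihomogeneous polynomial of bidegree $(k,k)$ in $(z_1,z_2)$, $(w_1,w_2)$ with coefficients in $\hat{\mathcal K}$, such that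 $\varphi(n,1,0,t_1,t_2)=\Lambda e^{-\tilde c_1x_1-\tilde c_2x_2}\varphi(n,t_1,t_2,0,1)$ for all $n$. Let $A$ be the ring of meromorphic functions on $\Omega$ with poles only on the curve $g(P)=0$, that is, the rational functions on $\mathbb{CP}^1\times\mathbb{CP}^1$ that are regular wherever $g\ne0$ and take equal values there at points identified in $\Omega$. Let $H$ be the set of those $h$ for which $\hat M_{\Omega,\Lambda}$ is a free $\mathcal T_2$-module of rank $2$ generated by two functions from $\hat M_{\Omega,\Lambda}(1)$. Then $H$ is uncountable, and for every $h\in H$ the ring $A$ embeds into ${\rm Mat}(2,\mathcal T_2)$. More precisely, for every $h\in H$ and every $\mathcal T_2$-basis $\Psi={}^t(\psi_1,\psi_2)$ of $\hat M_{\Omega,\Lambda}$ there is an injective homomorphism of $\mathbb C$-algebras $D:A\to{\rm Mat}(2,\mathcal T_2)$ with $D(\lambda)\Psi=\lambda\Psi$ for all $\lambda\in A$. -/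

import Mathlib

open scoped LinearAlgebra.Projectivization

namespace DBA

noncomputable section

/-! ### Bihomogeneous coordinates and the glued surface -/

/-- Index set of the homogeneous coordinates `(z₁, z₂, w₁, w₂)` on the product of two projective
lines: `Sum.inl i` is the index of `zᵢ`, `Sum.inr j` that of `wⱼ`. -/
abbrev Coord : Type := Fin 2 ⊕ Fin 2

/-- `p` is bihomogeneous of bidegree `(k, k)` in `(z₁, z₂)` and `(w₁, w₂)` (or zero). -/
def IsBihomogeneous {R : Type*} [CommSemiring R] (p : MvPolynomial Coord R) (k : ℕ) : Prop :=
  MvPolynomial.IsWeightedHomogeneous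
    (Sum.elim (fun _ => (1, 0)) (fun _ => (0, 1)) : Coord → ℕ × ℕ) p (k, k)

/-- The value at `(z, w)` of the bilinear form `∑ a i j * z i * w j`; for
`a = !![α, β; γ, δ]` it is `α z₁w₁ + β z₁w₂ + γ z₂w₁ + δ z₂w₂`. -/
def evalForm (a : Fin 2 → Fin 2 → ℂ) (z w : Fin 2 → ℂ) : ℂ :=
  ∑ i, ∑ j, a i j * z i * w j

/-- The same bilinear form as a polynomial with coefficients in a `ℂ`-algebra. -/
def formPoly (R : Type*) [CommRing R] [Algebra ℂ R] (a : Fin 2 → Fin 2 → ℂ) :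
    MvPolynomial Coord R :=
  ∑ i, ∑ j, MvPolynomial.C (algebraMap ℂ R (a i j)) *
    MvPolynomial.X (Sum.inl i) * MvPolynomial.X (Sum.inr j)

/-- The complex projective line. -/
abbrev P1 : Type := ℙ ℂ (Fin 2 → ℂ)

/-- The point `[1, 0]`. -/
def ptInfty : P1 := Projectivization.mk ℂ ![1, 0] (fun h => one_ne_zero (congrFun h 0))

/-- The point `[0, 1]`. -/
def ptZero : P1 := Projectivization.mk ℂ ![0, 1] (fun h => one_ne_zero (congrFun h 1))

/-- The generating identifications `([1, 0], t) ∼ (t, [0, 1])`. -/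
def GlueRel (P Q : P1 × P1) : Prop := ∃ t : P1, P = (ptInfty, t) ∧ Q = (t, ptZero)

/-- The surface `Ω`: the product of two projective lines modulo the equivalence relation generated
by `([1, 0], t) ∼ (t, [0, 1])`. -/
def Omega : Type := Quot GlueRel

/-- The point of `Ω` with bihomogeneous coordinates `(z, w)`. -/
def Omega.mk (z w : Fin 2 → ℂ) (hz : z ≠ 0) (hw : w ≠ 0) : Omega :=
  Quot.mk GlueRel (Projectivization.mk ℂ z hz, Projectivization.mk ℂ w hw)

/-! ### Meromorphic functions on the glued surface -/

/-- The field of rational functions of `(z, w)` with coefficients in a field `k`. -/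
abbrev RatFun (k : Type) [Field k] : Type := FractionRing (MvPolynomial Coord k)

/-- `r` is regular at the point with bihomogeneous coordinates `(z, w)`, with value `v` there:
it can be written as `p / q`, with `p`, `q` bihomogeneous of the same bidegree and
`q (z, w) ≠ 0`, and `v = p (z, w) / q (z, w)`. -/
def RegularWithValue (r : RatFun ℂ) (z w : Fin 2 → ℂ) (v : ℂ) : Prop :=
  ∃ (k : ℕ) (p q : MvPolynomial Coord ℂ), IsBihomogeneous p k ∧ IsBihomogeneous q k ∧
    MvPolynomial.eval (Sum.elim z w) q ≠ 0 ∧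
    r = algebraMap _ (RatFun ℂ) p / algebraMap _ (RatFun ℂ) q ∧
    v = MvPolynomial.eval (Sum.elim z w) p / MvPolynomial.eval (Sum.elim z w) q

theorem algebraMap_ne_zero_of_eval {q : MvPolynomial Coord ℂ} {P : Coord → ℂ}
    (h : MvPolynomial.eval P q ≠ 0) : algebraMap _ (RatFun ℂ) q ≠ 0 := by
  intro h0
  have : q = 0 := (map_eq_zero_iff _ (IsFractionRing.injective _ (RatFun ℂ))).1 h0
  exact h (by simp [this])

theorem RegularWithValue.add {r s : RatFun ℂ} {z w : Fin 2 → ℂ} {u v : ℂ}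
    (hr : RegularWithValue r z w u) (hs : RegularWithValue s z w v) :
    RegularWithValue (r + s) z w (u + v) := by
  obtain ⟨k, p, q, hp, hq, h0, rfl, rfl⟩ := hr
  obtain ⟨l, p', q', hp', hq', h0', rfl, rfl⟩ := hs
  have e := algebraMap_ne_zero_of_eval h0
  have e' := algebraMap_ne_zero_of_eval h0'
  refine ⟨k + l, p * q' + q * p', q * q', ?_, hq.mul hq', ?_, ?_, ?_⟩
  · exact (hp.mul hq').add (hq.mul hp')
  · simpa using ⟨h0, h0'⟩
  · rw [div_add_div _ _ e e']; simp only [map_add, map_mul]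
  · rw [div_add_div _ _ h0 h0']; simp only [map_add, map_mul]

theorem RegularWithValue.mul {r s : RatFun ℂ} {z w : Fin 2 → ℂ} {u v : ℂ}
    (hr : RegularWithValue r z w u) (hs : RegularWithValue s z w v) :
    RegularWithValue (r * s) z w (u * v) := by
  obtain ⟨k, p, q, hp, hq, h0, rfl, rfl⟩ := hr
  obtain ⟨l, p', q', hp', hq', h0', rfl, rfl⟩ := hs
  refine ⟨k + l, p * p', q * q', hp.mul hp', hq.mul hq', ?_, ?_, ?_⟩
  · simpa using ⟨h0, h0'⟩
  · rw [div_mul_div_comm]; simp only [map_mul]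
  · rw [div_mul_div_comm]; simp only [map_mul]

theorem RegularWithValue.const (c : ℂ) (z w : Fin 2 → ℂ) :
    RegularWithValue (algebraMap ℂ (RatFun ℂ) c) z w c := by
  refine ⟨0, MvPolynomial.C c, 1, MvPolynomial.isWeightedHomogeneous_C _ _,
    MvPolynomial.isWeightedHomogeneous_one _ _, by simp, ?_, by simp⟩
  rw [map_one, div_one, IsScalarTower.algebraMap_apply ℂ (MvPolynomial Coord ℂ) (RatFun ℂ)]
  rfl

/-- The ring `A` of meromorphic functions on `Ω` with poles only on the curve `g = 0`: the rational
functions on the product of two projective lines that are regular at every point where `g ≠ 0` and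
whose values there are those of a function on `Ω`, that is, agree at identified points. -/
def ringA (g : Fin 2 → Fin 2 → ℂ) : Subalgebra ℂ (RatFun ℂ) where
  carrier := {r | ∃ φ : Omega → ℂ, ∀ (z w : Fin 2 → ℂ) (hz : z ≠ 0) (hw : w ≠ 0),
    evalForm g z w ≠ 0 → RegularWithValue r z w (φ (Omega.mk z w hz hw))}
  mul_mem' := by
    rintro r s ⟨φ, hφ⟩ ⟨χ, hχ⟩
    exact ⟨fun P => φ P * χ P, fun z w hz hw h => (hφ z w hz hw h).mul (hχ z w hz hw h)⟩
  add_mem' := by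
    rintro r s ⟨φ, hφ⟩ ⟨χ, hχ⟩
    exact ⟨fun P => φ P + χ P, fun z w hz hw h => (hφ z w hz hw h).add (hχ z w hz hw h)⟩
  algebraMap_mem' c := ⟨fun _ => c, fun z w _ _ _ => RegularWithValue.const c z w⟩

/-! ### The data -/

/-- The data from which the discrete Baker-Akhiezer modules on `Ω` are built. -/
structure OmegaData where
  B : ℂ
  B_ne : B ≠ 0
  Λ : ℂ
  Λ_ne : Λ ≠ 0
  /-- The constants `c̃₁, c̃₂`. -/
  ct : Fin 2 → ℂ
  ct_ne : ∀ i, ct i ≠ 0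
  /-- Coefficients of the form `g`. -/
  g : Fin 2 → Fin 2 → ℂ
  g_ne : evalForm g ![0, 1] ![0, 1] ≠ 0
  g_glue : ∀ t : Fin 2 → ℂ, evalForm g ![1, 0] t = B * evalForm g t ![0, 1]
  /-- Coefficients of the forms `Gᵢ (·, s)`. -/
  G : Fin 2 → ℂ → Fin 2 → Fin 2 → ℂ
  G_glue : ∀ i s, ∀ t : Fin 2 → ℂ,
    evalForm (G i s) ![1, 0] t = B * Complex.exp s * evalForm (G i s) t ![0, 1]
  G_zero : ∀ i, G i 0 = g
  G_analytic : ∀ i, AnalyticAt ℂ (G i) 0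
  G_indep : LinearIndependent ℂ ![g, deriv (G 0) 0, deriv (G 1) 0]

/-! ### Coefficients and difference operators -/

/-- The field `𝒦` of rational functions of `e^(c̃₁x₁ + c̃₂x₂)`. As `c̃ ≠ 0`, this exponential is
transcendental over `ℂ`; it is the variable `RatFunc.X`. -/
abbrev Coeff : Type := RatFunc ℂ

/-- The substitution `X ↦ e^a X` on polynomials. -/
def expScalePoly (a : ℂ) : Polynomial ℂ →+* Polynomial ℂ :=
  Polynomial.compRingHom (Polynomial.C (Complex.exp a) * Polynomial.X)

theorem expScalePoly_injective (a : ℂ) : Function.Injective (expScalePoly a) := by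
  intro p q h
  have key : ∀ p : Polynomial ℂ, expScalePoly (-a) (expScalePoly a p) = p := by
    intro p
    simp only [expScalePoly, Polynomial.coe_compRingHom_apply, Polynomial.comp_assoc]
    have : (Polynomial.C (Complex.exp a) * Polynomial.X).comp
        (Polynomial.C (Complex.exp (-a)) * Polynomial.X) = Polynomial.X := by
      simp [← mul_assoc, ← Polynomial.C_mul, ← Complex.exp_add]
    rw [this, Polynomial.comp_X]
  rw [← key p, h, key q]

/-- The substitution `X ↦ e^a X` on rational functions. -/
def expScale (a : ℂ) : Coeff →+* Coeff :=
  RatFunc.mapRingHom (expScalePoly a)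
    (nonZeroDivisors_le_comap_nonZeroDivisors_of_injective _ (expScalePoly_injective a))

theorem expScale_X (a : ℂ) : expScale a RatFunc.X = RatFunc.C (Complex.exp a) * RatFunc.X := by
  have h := RatFunc.map_apply_div (expScalePoly a)
    (nonZeroDivisors_le_comap_nonZeroDivisors_of_injective _ (expScalePoly_injective a))
    Polynomial.X 1
  simpa [expScalePoly, expScale, RatFunc.coe_mapRingHom_eq_coe_map] using h

theorem expScale_C (a c : ℂ) : expScale a (RatFunc.C c) = RatFunc.C c := by
  have h := RatFunc.map_apply_div (expScalePoly a)
    (nonZeroDivisors_le_comap_nonZeroDivisors_of_injective _ (expScalePoly_injective a))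
    (Polynomial.C c) 1
  simpa [expScalePoly, expScale, RatFunc.coe_mapRingHom_eq_coe_map] using h

theorem expScale_ext {φ χ : Coeff →+* Coeff} (hC : ∀ c, φ (RatFunc.C c) = χ (RatFunc.C c))
    (hX : φ RatFunc.X = χ RatFunc.X) : φ = χ := by
  apply IsFractionRing.ringHom_ext (A := Polynomial ℂ)
  intro p
  have : (φ.comp (algebraMap (Polynomial ℂ) Coeff)) = χ.comp (algebraMap (Polynomial ℂ) Coeff) := by
    apply Polynomial.ringHom_ext
    · intro c; simpa using hC c
    · simpa using hX
  exact RingHom.congr_fun this p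

theorem expScale_add (a b : ℂ) : expScale (a + b) = (expScale a).comp (expScale b) := by
  apply expScale_ext
  · intro c; simp [expScale_C]
  · simp only [RingHom.comp_apply, expScale_X, map_mul, expScale_C, Complex.exp_add]
    ring

/-- The field of rational functions of `P = (z, w)` with coefficients in `𝒦`. -/
abbrev ValueField : Type := RatFun Coeff

/-- Functions of `n ∈ ℤ²` with values in the rational functions of `P` over `𝒦`. -/
abbrev DiscreteFun : Type := (Fin 2 → ℤ) → ValueField

/-- The function field of the curve along which the gluing takes place, with coordinates
`t = (t₁, t₂)`, over `𝒦`. -/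
abbrev LineField : Type := FractionRing (MvPolynomial (Fin 2) Coeff)

/-- The restriction `p ↦ p (1, 0, t₁, t₂)`. -/
def restrictFst : MvPolynomial Coord Coeff →+* LineField :=
  (algebraMap (MvPolynomial (Fin 2) Coeff) LineField).comp
    (MvPolynomial.aeval (Sum.elim ![1, 0] MvPolynomial.X)).toRingHom

/-- The restriction `p ↦ p (t₁, t₂, 0, 1)`. -/
def restrictSnd : MvPolynomial Coord Coeff →+* LineField :=
  (algebraMap (MvPolynomial (Fin 2) Coeff) LineField).comp
    (MvPolynomial.aeval (Sum.elim MvPolynomial.X ![0, 1])).toRingHom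

namespace OmegaData

variable (F : OmegaData) (h : Fin 2 → ℂ)

/-- The form `gᵢ = Gᵢ (·, c̃ᵢ hᵢ)`. -/
def gi (i : Fin 2) : Fin 2 → Fin 2 → ℂ := F.G i (F.ct i * h i)

/-- The parameters `h ∈ (ℂ \ {0})²` for which the forms `g₁, g₂` do not vanish identically on the
glued curves, so that the products `∏ (gⱼ / g) ^ nⱼ`, `n ∈ ℤ²`, make sense there. -/
def Admissible : Prop :=
  ∀ i, h i ≠ 0 ∧ evalForm (F.gi h i) ![0, 1] ![0, 1] ≠ 0

/-- The translation `f(x) ↦ f(x + nh)`, `nh = (n₁h₁, n₂h₂)`, of `𝒦`. -/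
def shift (n : Fin 2 → ℤ) : Coeff →+* Coeff := expScale (∑ i, F.ct i * (n i * h i))

/-- Multiplication by the discrete function `n ↦ f(x + nh)`. -/
def mulHat (f : Coeff) : Module.End ℂ DiscreteFun where
  toFun ψ n := algebraMap Coeff ValueField (F.shift h n f) * ψ n
  map_add' ψ χ := by ext n; simp [mul_add]
  map_smul' c ψ := by ext n; simp

/-- The shift operator `Tᵢ` of the `i`-th discrete variable. -/
def opT (i : Fin 2) : Module.End ℂ DiscreteFun where
  toFun ψ n := ψ (n + Pi.single i 1)
  map_add' _ _ := rfl
  map_smul' _ _ := rfl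

/-- The ring `𝒯₂` of difference operators, generated by `T₁, T₂` and the multiplications by the
discrete functions `n ↦ f(x + nh)`, `f ∈ 𝒦`. -/
def T2 : Subalgebra ℂ (Module.End ℂ DiscreteFun) :=
  Algebra.adjoin ℂ (Set.range (F.mulHat h) ∪ Set.range opT)

/-! ### The discrete Baker-Akhiezer module -/

/-- For `p(n, P)` whose coefficients are the discrete functions belonging to the coefficients of
`p`, the value `p(n, P) / g(P) ^ k * ∏ j, (gⱼ(P) / g(P)) ^ nⱼ`, where `ρ` substitutes for `P` the
generic point of the whole surface or of one of the two glued curves. -/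
def value {L : Type} [Field L] (ρ : MvPolynomial Coord Coeff →+* L)
    (k : ℕ) (p : MvPolynomial Coord Coeff) (n : Fin 2 → ℤ) : L :=
  ρ (MvPolynomial.map (F.shift h n) p) / ρ (formPoly Coeff F.g) ^ k *
    ∏ j, (ρ (formPoly Coeff (F.gi h j)) / ρ (formPoly Coeff F.g)) ^ n j

/-- The factor `Λ e^(-(c̃₁x₁ + c̃₂x₂))`. -/
def multiplier : LineField := algebraMap Coeff LineField (RatFunc.C F.Λ * RatFunc.X⁻¹)

/-- The `k`-th piece of the discrete Baker-Akhiezer module: the functions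
`ψ(n, P) = p(n, P) / g(P) ^ k * ∏ j, (gⱼ(P) / g(P)) ^ nⱼ`, `p` of bidegree `(k, k)`, with
`ψ(n, 1, 0, t) = Λ e^(-(c̃₁x₁ + c̃₂x₂)) ψ(n, t, 0, 1)`. -/
def piece (k : ℕ) : Set DiscreteFun :=
  {ψ | ∃ p : MvPolynomial Coord Coeff, IsBihomogeneous p k ∧
    (∀ n, ψ n = F.value h (algebraMap _ ValueField) k p n) ∧
    ∀ n, F.value h restrictFst k p n = F.multiplier * F.value h restrictSnd k p n}

theorem evalForm_zero_one (a : Fin 2 → Fin 2 → ℂ) : evalForm a ![0, 1] ![0, 1] = a 1 1 := by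
  simp [evalForm]

theorem restrictSnd_ne (a : Fin 2 → Fin 2 → ℂ) (h1 : evalForm a ![0, 1] ![0, 1] ≠ 0) :
    restrictSnd (formPoly Coeff a) ≠ 0 := by
  rw [evalForm_zero_one] at h1
  intro h0
  change algebraMap (MvPolynomial (Fin 2) Coeff) LineField (MvPolynomial.aeval
    (Sum.elim MvPolynomial.X ![0, 1]) (formPoly Coeff a)) = 0 at h0
  have h2 := (map_eq_zero_iff _ (IsFractionRing.injective _ LineField)).1 h0
  have h3 := congrArg (MvPolynomial.eval (![0, 1] : Fin 2 → Coeff)) h2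
  simp [formPoly] at h3
  exact h1 h3

theorem restrictFst_ne (a : Fin 2 → Fin 2 → ℂ) (c : ℂ) (hc : c ≠ 0)
    (h1 : evalForm a ![0, 1] ![0, 1] ≠ 0)
    (hg : ∀ t : Fin 2 → ℂ, evalForm a ![1, 0] t = c * evalForm a t ![0, 1]) :
    restrictFst (formPoly Coeff a) ≠ 0 := by
  have h01 : evalForm a ![1, 0] ![0, 1] ≠ 0 := by rw [hg]; exact mul_ne_zero hc h1
  have h01' : a 0 1 ≠ 0 := by simpa [evalForm] using h01
  intro h0
  change algebraMap (MvPolynomial (Fin 2) Coeff) LineField (MvPolynomial.aeval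
    (Sum.elim ![1, 0] MvPolynomial.X) (formPoly Coeff a)) = 0 at h0
  have h2 := (map_eq_zero_iff _ (IsFractionRing.injective _ LineField)).1 h0
  have h3 := congrArg (MvPolynomial.eval (![0, 1] : Fin 2 → Coeff)) h2
  simp [formPoly] at h3
  exact h01' h3

theorem formPoly_ne (a : Fin 2 → Fin 2 → ℂ) (h1 : evalForm a ![0, 1] ![0, 1] ≠ 0) :
    algebraMap _ ValueField (formPoly Coeff a) ≠ 0 := by
  intro h0
  have h2 := (map_eq_zero_iff _ (IsFractionRing.injective _ ValueField)).1 h0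
  exact restrictSnd_ne a h1 (by rw [h2, map_zero])

theorem formPoly_bihomogeneous (a : Fin 2 → Fin 2 → ℂ) :
    IsBihomogeneous (formPoly Coeff a) 1 := by
  have key : ∀ i j : Fin 2, IsBihomogeneous (MvPolynomial.C (algebraMap ℂ Coeff (a i j)) *
      MvPolynomial.X (Sum.inl i) * MvPolynomial.X (Sum.inr j)) 1 := by
    intro i j
    have := ((MvPolynomial.isWeightedHomogeneous_C
      (Sum.elim (fun _ => (1, 0)) (fun _ => (0, 1)) : Coord → ℕ × ℕ)
      (algebraMap ℂ Coeff (a i j))).mul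
      (MvPolynomial.isWeightedHomogeneous_X Coeff _ (Sum.inl i))).mul
      (MvPolynomial.isWeightedHomogeneous_X Coeff _ (Sum.inr j))
    simpa [IsBihomogeneous] using this
  simp only [formPoly, Fin.sum_univ_two]
  exact ((key 0 0).add (key 0 1)).add ((key 1 0).add (key 1 1))

theorem shift_add (m n : Fin 2 → ℤ) : F.shift h (m + n) = (F.shift h m).comp (F.shift h n) := by
  simp only [shift]
  rw [← expScale_add]
  congr 1
  simp only [Fin.sum_univ_two, Pi.add_apply, Int.cast_add]
  ring

theorem expScale_algebraMap (a c : ℂ) : expScale a (algebraMap ℂ Coeff c) = algebraMap ℂ Coeff c :=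
  expScale_C a c

theorem map_shift_form (n : Fin 2 → ℤ) (a : Fin 2 → Fin 2 → ℂ) :
    MvPolynomial.map (F.shift h n) (formPoly Coeff a) = formPoly Coeff a := by
  simp [formPoly, shift, expScale_C]

theorem map_bihomogeneous {p : MvPolynomial Coord Coeff} {k : ℕ} (hp : IsBihomogeneous p k)
    (φ : Coeff →+* Coeff) : IsBihomogeneous (MvPolynomial.map φ p) k := by
  intro d hd
  apply hp
  intro h0
  exact hd (by rw [MvPolynomial.coeff_map, h0, map_zero])

section closure

variable {L : Type} [Field L] (ρ : MvPolynomial Coord Coeff →+* L)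

theorem value_add (k : ℕ) (p q : MvPolynomial Coord Coeff) (n : Fin 2 → ℤ) :
    F.value h ρ k (p + q) n = F.value h ρ k p n + F.value h ρ k q n := by
  simp only [value, map_add]; ring

theorem value_raise (hρ : ρ (formPoly Coeff F.g) ≠ 0) (k l : ℕ) (p : MvPolynomial Coord Coeff)
    (n : Fin 2 → ℤ) :
    F.value h ρ (k + l) (p * formPoly Coeff F.g ^ l) n = F.value h ρ k p n := by
  simp only [value, map_mul, map_pow, map_shift_form, pow_add]
  rw [mul_div_mul_right _ _ (pow_ne_zero _ hρ)]

theorem value_coeff (k : ℕ) (f : Coeff) (p : MvPolynomial Coord Coeff) (n : Fin 2 → ℤ) :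
    F.value h ρ k (MvPolynomial.C f * p) n =
      ρ (MvPolynomial.C (F.shift h n f)) * F.value h ρ k p n := by
  simp only [value, map_mul, MvPolynomial.map_C]; ring

theorem value_shift (hρ : ρ (formPoly Coeff F.g) ≠ 0) (i : Fin 2)
    (hρi : ρ (formPoly Coeff (F.gi h i)) ≠ 0) (k : ℕ)
    (p : MvPolynomial Coord Coeff) (n : Fin 2 → ℤ) :
    F.value h ρ (k + 1) (formPoly Coeff (F.gi h i) *
      MvPolynomial.map (F.shift h (Pi.single i 1)) p) n = F.value h ρ k p (n + Pi.single i 1) := by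
  have hprod : ∏ j, (ρ (formPoly Coeff (F.gi h j)) / ρ (formPoly Coeff F.g)) ^
      (n + Pi.single i 1 : Fin 2 → ℤ) j =
      (ρ (formPoly Coeff (F.gi h i)) / ρ (formPoly Coeff F.g)) *
      ∏ j, (ρ (formPoly Coeff (F.gi h j)) / ρ (formPoly Coeff F.g)) ^ n j := by
    have hne := div_ne_zero hρi hρ
    fin_cases i <;> simp [Fin.prod_univ_two] at hne ⊢ <;> rw [zpow_add₀ (by simpa using hne)] <;>
      rw [zpow_one] <;> ring
  simp only [value]
  rw [hprod, shift_add, map_mul, map_shift_form, MvPolynomial.map_map, map_mul, pow_succ]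
  field_simp

end closure

theorem restrict_C (f : Coeff) :
    restrictFst (MvPolynomial.C f) = restrictSnd (MvPolynomial.C f) := by
  simp [restrictFst, restrictSnd]

theorem piece_raise {k : ℕ} (l : ℕ) {ψ : DiscreteFun} (hψ : ψ ∈ F.piece h k) :
    ψ ∈ F.piece h (k + l) := by
  obtain ⟨p, hp, h1, h2⟩ := hψ
  refine ⟨p * formPoly Coeff F.g ^ l, ?_, fun n => ?_, fun n => ?_⟩
  · have := hp.mul ((formPoly_bihomogeneous F.g).pow l)
    simpa [IsBihomogeneous] using this
  · rw [h1, F.value_raise h _ (formPoly_ne _ F.g_ne)]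
  · rw [F.value_raise h _ (restrictFst_ne _ _ F.B_ne F.g_ne F.g_glue),
      F.value_raise h _ (restrictSnd_ne _ F.g_ne), h2]

theorem piece_add {k : ℕ} {ψ χ : DiscreteFun} (hψ : ψ ∈ F.piece h k) (hχ : χ ∈ F.piece h k) :
    ψ + χ ∈ F.piece h k := by
  obtain ⟨p, hp, h1, h2⟩ := hψ
  obtain ⟨q, hq, h3, h4⟩ := hχ
  refine ⟨p + q, hp.add hq, fun n => ?_, fun n => ?_⟩
  · rw [value_add, Pi.add_apply, h1, h3]
  · rw [value_add, value_add, h2, h4, mul_add]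

theorem piece_zero : (0 : DiscreteFun) ∈ F.piece h 0 :=
  ⟨0, MvPolynomial.isWeightedHomogeneous_zero _ _ _, fun n => by simp [value],
    fun n => by simp [value]⟩

theorem piece_mulHat {k : ℕ} (f : Coeff) {ψ : DiscreteFun} (hψ : ψ ∈ F.piece h k) :
    F.mulHat h f ψ ∈ F.piece h k := by
  obtain ⟨p, hp, h1, h2⟩ := hψ
  refine ⟨MvPolynomial.C f * p, ?_, fun n => ?_, fun n => ?_⟩
  · have := (MvPolynomial.isWeightedHomogeneous_C _ f).mul hp
    simpa [IsBihomogeneous] using this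
  · rw [value_coeff]
    change algebraMap Coeff ValueField (F.shift h n f) * ψ n = _
    rw [h1, IsScalarTower.algebraMap_apply Coeff (MvPolynomial Coord Coeff) ValueField]
    rfl
  · rw [value_coeff, value_coeff, h2, restrict_C]; ring

theorem piece_opT {k : ℕ} (hadm : F.Admissible h) (i : Fin 2) {ψ : DiscreteFun}
    (hψ : ψ ∈ F.piece h k) : opT i ψ ∈ F.piece h (k + 1) := by
  obtain ⟨p, hp, h1, h2⟩ := hψ
  have hi := (hadm i).2
  refine ⟨formPoly Coeff (F.gi h i) * MvPolynomial.map (F.shift h (Pi.single i 1)) p,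
    ?_, fun n => ?_, fun n => ?_⟩
  · have := (formPoly_bihomogeneous (F.gi h i)).mul (map_bihomogeneous hp (F.shift h (Pi.single i 1)))
    rw [add_comm k 1]
    simpa [IsBihomogeneous] using this
  · rw [F.value_shift h _ (formPoly_ne _ F.g_ne) i (formPoly_ne _ hi)]
    exact h1 _
  · rw [F.value_shift h _ (restrictFst_ne _ _ F.B_ne F.g_ne F.g_glue) i
        (restrictFst_ne _ _ (mul_ne_zero F.B_ne (Complex.exp_ne_zero _)) hi (F.G_glue i _)),
      F.value_shift h _ (restrictSnd_ne _ F.g_ne) i (restrictSnd_ne _ hi), h2]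

/-- The discrete Baker-Akhiezer module, the union of its pieces, as a module over `𝒯₂`. -/
def baModule (hadm : F.Admissible h) : Submodule (F.T2 h) DiscreteFun where
  carrier := {ψ | ∃ k, ψ ∈ F.piece h k}
  add_mem' := by
    rintro ψ χ ⟨k, hk⟩ ⟨l, hl⟩
    exact ⟨k + l, F.piece_add h (F.piece_raise h l hk) (add_comm l k ▸ F.piece_raise h k hl)⟩
  zero_mem' := ⟨0, F.piece_zero h⟩
  smul_mem' := by
    rintro ⟨D, hD⟩ ψ hψ
    change ∃ k, D ψ ∈ F.piece h k
    change ∃ k, ψ ∈ F.piece h k at hψ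
    revert ψ
    induction hD using Algebra.adjoin_induction with
    | mem D hD =>
      intro ψ hψ
      obtain ⟨k, hk⟩ := hψ
      rcases hD with ⟨f, rfl⟩ | ⟨i, rfl⟩
      · exact ⟨k, F.piece_mulHat h f hk⟩
      · exact ⟨k + 1, F.piece_opT h hadm i hk⟩
    | algebraMap c =>
      intro ψ hψ
      obtain ⟨k, hk⟩ := hψ
      have := F.piece_mulHat h (RatFunc.C c) hk
      refine ⟨k, ?_⟩
      convert this using 1
      ext n
      change c • ψ n = algebraMap Coeff ValueField (expScale _ (RatFunc.C c)) * ψ n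
      rw [expScale_C, Algebra.smul_def, IsScalarTower.algebraMap_apply ℂ Coeff ValueField]
      rfl
    | add D E _ _ hD hE =>
      intro ψ hψ
      obtain ⟨k, hk⟩ := hD hψ
      obtain ⟨l, hl⟩ := hE hψ
      exact ⟨k + l, F.piece_add h (F.piece_raise h l hk) (add_comm l k ▸ F.piece_raise h k hl)⟩
    | mul D E _ _ hD hE => exact fun hψ => hD (hE hψ)

/-- `(ψ₁, ψ₂)` is a basis of the discrete Baker-Akhiezer module over `𝒯₂`. -/
def IsBasis (hadm : F.Admissible h) (ψ : Fin 2 → DiscreteFun) : Prop :=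
  LinearIndependent (F.T2 h) ψ ∧ Submodule.span (F.T2 h) (Set.range ψ) = F.baModule h hadm

/-- The parameters `h` for which the discrete Baker-Akhiezer module is a free `𝒯₂`-module of rank
two generated by two functions from its first piece. -/
def freeParameters : Set (Fin 2 → ℂ) :=
  {h | ∃ hadm : F.Admissible h, ∃ ψ : Fin 2 → DiscreteFun,
    (∀ i, ψ i ∈ F.piece h 1) ∧ F.IsBasis h hadm ψ}

end OmegaData

/-- Extension of coefficients from `ℂ` to `𝒦`: a rational function of `P` regarded as a value of
discrete functions. -/
def extendCoeff : RatFun ℂ →+* ValueField :=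
  IsFractionRing.map (A := MvPolynomial Coord ℂ) (j := MvPolynomial.map (algebraMap ℂ Coeff))
    (MvPolynomial.map_injective _ (algebraMap ℂ Coeff).injective)

end

end DBA

namespace DBA
noncomputable section

/-! Write q = e^s, μ = BΛ/X, c = z₂w₁, and v_t for the form `glueForm t`. On the diagonal c̃₁h₁ =
c̃₂h₂ = s both g₁ and g₂ are combinations of c and v_{Bq}. If they are independent, constant
combinations U, V of T₁, T₂ act on numerators as the shift X ↦ qX followed by multiplication by c,
respectively v_{Bq}. The candidate basis is c/g, v_μ/g. Since the shift sends μ to μ/q, the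
operators Uⁱ Vʲ with i + j ≤ N produce, over the common denominator g^(N+1), the (N+1)(N+2)
numerators cⁱ vʲ g^(N-i-j) with a further factor c or v_{μ q^(-i-j)}, where v = v_{Bq}.

These are independent over 𝒦 (`formSum_eq_zero`), and the space of glued numerators of that bidegree
has dimension at most (N+1)(N+2) (`finrank_gluedForms_le`), so they span it
(`exists_eq_sum_formFamily`). Every operator of 𝒯₂ has a normal form ∑ f Uⁱ Vʲ
(`IsDiagonal.mem_range_normalOp`); hence independence gives freeness and spanning gives generation.

The diagonal conditions hold for all small s ≠ 0: the determinant of (g₁, g₂) vanishes at s = 0, but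
its derivative does not, by the independence of g, ∂G₁, ∂G₂. This yields uncountably many h.

For the embedding, each λ ∈ A equals p/g^N with p glued by the factor B^N (`exists_eq_div_pow`,
`aeval_fst_eq`), so multiplication by λ preserves the module. The coordinates of λψᵢ in the basis
form D(λ), which is multiplicative because 𝒯₂ commutes with multiplication by functions of P alone.
-/

open MvPolynomial in
/-- The bilinear form `z₂w₁`. -/
def crossForm (K : Type*) [Field K] : MvPolynomial Coord K := X (Sum.inl 1) * X (Sum.inr 0)

open MvPolynomial in
/-- The bilinear form `t²z₁w₁ + t z₁w₂ + z₂w₂`, which spans, together with `z₂w₁`, the forms `a`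
with `a (1, 0, u) = t a (u, 0, 1)`. -/
def glueForm {K : Type*} [Field K] (t : K) : MvPolynomial Coord K :=
  C (t ^ 2) * X (Sum.inl 0) * X (Sum.inr 0) + C t * X (Sum.inl 0) * X (Sum.inr 1) +
    X (Sum.inl 1) * X (Sum.inr 1)

/-! ### Linear independence of the products of forms. -/

section Independence

variable {K : Type*} [Field K]

/-- The j-th summand has degree exactly j + 1 unless `e j = 0`, so the coefficients vanish one by
one from the top. -/
theorem eq_zero_of_sum_mul_linear_eq_zero (a b e : ℕ → K) (ha : ∀ j, a j ≠ 0) (N : ℕ)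
    (h : ∑ j ∈ Finset.range N, Polynomial.C (e j) * Polynomial.X ^ j *
      (Polynomial.C (a j) * Polynomial.X + Polynomial.C (b j)) = 0) :
    ∀ j < N, e j = 0 := by
  induction N with
  | zero => intro j hj; omega
  | succ N ih =>
    have hdeg : ∀ j, (Polynomial.C (e j) * Polynomial.X ^ j *
        (Polynomial.C (a j) * Polynomial.X + Polynomial.C (b j))).coeff (N + 1) =
        if j = N then e j * a j else if j = N + 1 then e j * b j else 0 := by
      intro j
      rw [mul_assoc, Polynomial.coeff_C_mul, mul_add, Polynomial.coeff_add,
        mul_left_comm, ← pow_succ, mul_comm (Polynomial.X ^ j), Polynomial.coeff_C_mul,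
        Polynomial.coeff_C_mul, Polynomial.coeff_X_pow, Polynomial.coeff_X_pow]
      by_cases h1 : j = N
      · subst h1; simp
      · by_cases h2 : j = N + 1
        · subst h2; simp
        · rw [if_neg (by omega), if_neg (by omega), if_neg h1, if_neg h2]; simp
    have hN : e N = 0 := by
      have := congrArg (fun p => Polynomial.coeff p (N + 1)) h
      simp only [Polynomial.finsetSum_coeff, hdeg, Polynomial.coeff_zero] at this
      rw [Finset.sum_range_succ, Finset.sum_eq_zero] at this
      · simpa [ha N] using this
      · intro j hj
        have := Finset.mem_range.1 hj
        rw [if_neg (by omega), if_neg (by omega)]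
    rw [Finset.sum_range_succ, hN] at h
    intro j hj
    rcases Nat.lt_succ_iff_lt_or_eq.1 hj with h1 | h1
    · exact ih (by simpa using h) j h1
    · rw [h1, hN]

theorem eq_zero_of_sum_C_mul_X_pow_eq_zero (f : ℕ → K) (N : ℕ)
    (h : ∑ j ∈ Finset.range N, Polynomial.C (f j) * Polynomial.X ^ j = 0) :
    ∀ j < N, f j = 0 := by
  intro j hj
  have := congrArg (fun p => Polynomial.coeff p j) h
  simpa [Polynomial.finsetSum_coeff, Polynomial.coeff_X_pow, hj] using this

variable (B q δ γ : K)

/-- A general combination of the products `cⁱ vʲ Gᴷ⁻ⁱ⁻ʲ` and `v_{μ q⁻ⁱ⁻ʲ} cⁱ vʲ Gᴷ⁻¹⁻ⁱ⁻ʲ`, where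
`c = z₂w₁`, `v = v_{Bq}` and `G = δ v_B + γ c`. -/
def formSum (N : ℕ) (μ : K) (f e : ℕ → ℕ → K) : MvPolynomial Coord K :=
  ∑ i ∈ Finset.range (N + 1), ∑ j ∈ Finset.range (N + 1 - i),
    MvPolynomial.C (f i j) * (crossForm K ^ i * glueForm (B * q) ^ j *
      (MvPolynomial.C δ * glueForm B + MvPolynomial.C γ * crossForm K) ^ (N - i - j)) +
  ∑ i ∈ Finset.range N, ∑ j ∈ Finset.range (N - i),
    MvPolynomial.C (e i j) * (glueForm (μ * q⁻¹ ^ (i + j)) *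
      (crossForm K ^ i * glueForm (B * q) ^ j *
      (MvPolynomial.C δ * glueForm B + MvPolynomial.C γ * crossForm K) ^ (N - 1 - i - j)))

/-- The terms with i = 0 are split off, as only they survive where c = 0. The rest is c times a sum
of the same kind, with μ/q for μ because q^(-(i+1)-j) = q⁻¹ q^(-i-j). Dividing by c creates terms c⁰
vʲ Gᴷ⁻ʲ, which is why `formSum` allows them. -/
theorem formSum_succ (N : ℕ) (μ : K) (f e : ℕ → ℕ → K) :
    formSum B q δ γ (N + 1) μ f e =
      (∑ j ∈ Finset.range (N + 2), MvPolynomial.C (f 0 j) * (glueForm (B * q) ^ j *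
        (MvPolynomial.C δ * glueForm B + MvPolynomial.C γ * crossForm K) ^ (N + 1 - j)) +
      ∑ j ∈ Finset.range (N + 1), MvPolynomial.C (e 0 j) * (glueForm (μ * q⁻¹ ^ j) *
        (glueForm (B * q) ^ j *
        (MvPolynomial.C δ * glueForm B + MvPolynomial.C γ * crossForm K) ^ (N - j)))) +
      crossForm K * formSum B q δ γ N (μ * q⁻¹) (fun i j => f (i + 1) j)
        (fun i j => e (i + 1) j) := by
  set G := MvPolynomial.C δ * glueForm B + MvPolynomial.C γ * crossForm K with hG
  have h1 : ∀ i j, MvPolynomial.C (f (i + 1) j) * (crossForm K ^ (i + 1) * glueForm (B * q) ^ j *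
      G ^ (N - i - j)) = crossForm K * (MvPolynomial.C (f (i + 1) j) *
      (crossForm K ^ i * glueForm (B * q) ^ j * G ^ (N - i - j))) := by
    intro i j
    ring
  have h2 : ∀ i j, MvPolynomial.C (e (i + 1) j) * (glueForm (μ * q⁻¹ ^ (i + 1 + j)) *
      (crossForm K ^ (i + 1) * glueForm (B * q) ^ j * G ^ (N - (i + 1) - j))) =
      crossForm K * (MvPolynomial.C (e (i + 1) j) * (glueForm (μ * q⁻¹ * q⁻¹ ^ (i + j)) *
      (crossForm K ^ i * glueForm (B * q) ^ j * G ^ (N - 1 - i - j)))) := by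
    intro i j
    rw [show μ * q⁻¹ * q⁻¹ ^ (i + j) = μ * q⁻¹ ^ (i + 1 + j) by ring,
      show N - (i + 1) - j = N - 1 - i - j by omega]
    ring
  have h3 : ∀ i, N + 1 + 1 - (i + 1) = N + 1 - i := fun i => by omega
  have h4 : ∀ i, N + 1 - (i + 1) = N - i := fun i => by omega
  simp only [formSum, ← hG]
  refine (congrArg₂ (· + ·) (Finset.sum_range_succ' _ _) (Finset.sum_range_succ' _ _)).trans ?_
  simp only [h3, h4]
  simp only [h1, h2, ← Finset.mul_sum, pow_zero, one_mul, Nat.sub_zero, zero_add]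
  ring

variable {B q δ γ}

/-- On the two glued curves c = 0, and v_τ becomes τt₁ + t₂ on one and τ(τt₁ + t₂) on the other.
From the first curve to the second every e-term gains the same factor μBᴺ, while the j-th f-term
gains Bᴺ⁺¹qʲ. Subtracting eliminates the e-terms and forces f 0 j = 0 as μ ≠ Bqʲ; then e 0 j = 0 by
degrees. What remains is divisible by c, and induction applies. -/
theorem formSum_eq_zero (hB : B ≠ 0) (hq : q ≠ 0) (hq1 : q ≠ 1) (hδ : δ ≠ 0) (N : ℕ) :
    ∀ (μ : K) (f e : ℕ → ℕ → K), (∀ n : ℤ, μ ≠ B * q ^ n) → formSum B q δ γ N μ f e = 0 →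
      (∀ i j, i + j ≤ N → f i j = 0) ∧ ∀ i j, i + j < N → e i j = 0 := by
  induction N with
  | zero =>
    intro μ f e _ h
    refine ⟨fun i j hij => ?_, fun i j hij => by omega⟩
    obtain ⟨rfl, rfl⟩ : i = 0 ∧ j = 0 := by omega
    simpa [formSum] using h
  | succ N ih =>
    intro μ f e hμ h
    rw [formSum_succ] at h
    -- Solving Bt₁ + t₂ = 1 and Bqt₁ + t₂ = X gives t₁ = (X - 1)/(B(q - 1)).
    set β : K := (B * (q - 1))⁻¹ with hβ
    have hβ' : B * (q - 1) * β = 1 :=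
      mul_inv_cancel₀ (mul_ne_zero hB (sub_ne_zero.2 hq1))
    have hβ0 : β ≠ 0 := inv_ne_zero (mul_ne_zero hB (sub_ne_zero.2 hq1))
    -- the two coordinates of a parametrization of the line on which `v_B = 1` and `v_{Bq} = T`
    let t₁ : Polynomial K := Polynomial.C β * (Polynomial.X - 1)
    let t₂ : Polynomial K := 1 - Polynomial.C B * t₁
    have hx : Polynomial.C B * t₁ + t₂ = 1 := by simp [t₂]
    have hy : Polynomial.C (B * q) * t₁ + t₂ = Polynomial.X := by
      have : Polynomial.C (B * (q - 1) * β) = (1 : Polynomial K) := by rw [hβ']; simp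
      simp only [t₁, t₂, map_mul, map_sub, map_one] at this ⊢
      linear_combination (Polynomial.X - 1) * this
    have hv : ∀ t, Polynomial.C t * t₁ + t₂ =
        Polynomial.C ((t - B) * β) * Polynomial.X + Polynomial.C (1 - (t - B) * β) := by
      intro t; simp only [t₁, t₂, map_mul, map_sub, map_one]; ring
    -- φ and χ restrict to the curves (t, 0, 1) and (1, 0, t) along this parametrization.
    let φ : MvPolynomial Coord K →+* Polynomial K :=
      MvPolynomial.eval₂Hom Polynomial.C (Sum.elim ![t₁, t₂] ![0, 1])
    let χ : MvPolynomial Coord K →+* Polynomial K :=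
      MvPolynomial.eval₂Hom Polynomial.C (Sum.elim ![1, 0] ![t₁, t₂])
    have φC : ∀ a, φ (MvPolynomial.C a) = Polynomial.C a := by simp [φ]
    have χC : ∀ a, χ (MvPolynomial.C a) = Polynomial.C a := by simp [χ]
    have φc : φ (crossForm K) = 0 := by simp [φ, crossForm]
    have χc : χ (crossForm K) = 0 := by simp [χ, crossForm]
    have φv : ∀ t, φ (glueForm t) = Polynomial.C t * t₁ + t₂ := by
      intro t; simp [φ, glueForm]
    have χv : ∀ t, χ (glueForm t) = Polynomial.C t * (Polynomial.C t * t₁ + t₂) := by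
      intro t; simp [χ, glueForm]; ring
    have hφ := congrArg φ h
    have hχ := congrArg χ h
    simp only [map_add, map_mul, map_sum, map_pow, φC, φc, φv, zero_mul, mul_zero, add_zero, hx,
      map_zero, mul_one] at hφ
    simp only [map_add, map_mul, map_sum, map_pow, χC, χc, χv, zero_mul, mul_zero, add_zero, hx,
      map_zero, mul_one] at hχ
    simp only [map_mul] at hy
    simp only [hy] at hφ hχ
    have hf : ∀ j < N + 2, f 0 j * δ ^ (N + 1 - j) * (B ^ (N + 1) * q ^ j - μ * B ^ N) = 0 := by
      apply eq_zero_of_sum_C_mul_X_pow_eq_zero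
      have e1 : ∀ j ∈ Finset.range (N + 2),
          Polynomial.C (f 0 j * δ ^ (N + 1 - j) * (B ^ (N + 1) * q ^ j - μ * B ^ N)) *
            Polynomial.X ^ j =
          Polynomial.C (f 0 j) * ((Polynomial.C B * Polynomial.C q * Polynomial.X) ^ j *
            (Polynomial.C δ * Polynomial.C B) ^ (N + 1 - j)) -
          Polynomial.C (μ * B ^ N) * (Polynomial.C (f 0 j) * (Polynomial.X ^ j *
            (Polynomial.C δ) ^ (N + 1 - j))) := by
        intro j hj
        obtain ⟨l, hl⟩ := Nat.exists_eq_add_of_le (Nat.lt_succ_iff.1 (Finset.mem_range.1 hj))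
        rw [hl, Nat.add_sub_cancel_left]
        simp only [map_mul, map_sub, map_pow]
        ring
      -- The powers of q cancel: μq⁻ʲ (Bq)ʲ Bᴺ⁻ʲ = μBᴺ for every j.
      have e2 : ∀ j ∈ Finset.range (N + 1),
          Polynomial.C (e 0 j) * (Polynomial.C μ * Polynomial.C q⁻¹ ^ j *
            (Polynomial.C μ * Polynomial.C q⁻¹ ^ j * t₁ + t₂) *
            ((Polynomial.C B * Polynomial.C q * Polynomial.X) ^ j *
            (Polynomial.C δ * Polynomial.C B) ^ (N - j))) =
          Polynomial.C (μ * B ^ N) * (Polynomial.C (e 0 j) *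
            ((Polynomial.C μ * Polynomial.C q⁻¹ ^ j * t₁ + t₂) *
            (Polynomial.X ^ j * Polynomial.C δ ^ (N - j)))) := by
        intro j hj
        obtain ⟨l, hl⟩ := Nat.exists_eq_add_of_le (Nat.lt_succ_iff.1 (Finset.mem_range.1 hj))
        have hqq : Polynomial.C q⁻¹ ^ j * Polynomial.C q ^ j = (1 : Polynomial K) := by
          rw [← mul_pow, ← Polynomial.C_mul, inv_mul_cancel₀ hq]; simp
        rw [hl, Nat.add_sub_cancel_left]
        simp only [map_mul, map_pow]
        linear_combination (Polynomial.C (e 0 j) * Polynomial.C μ *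
            (Polynomial.C μ * Polynomial.C q⁻¹ ^ j * t₁ + t₂) * Polynomial.C B ^ (j + l) *
            Polynomial.X ^ j * Polynomial.C δ ^ l) * hqq
      rw [Finset.sum_congr rfl e1, Finset.sum_sub_distrib, ← Finset.mul_sum]
      rw [Finset.sum_congr rfl e2, ← Finset.mul_sum] at hχ
      linear_combination hχ - Polynomial.C (μ * B ^ N) * hφ
    have hf0 : ∀ j < N + 2, f 0 j = 0 := by
      intro j hj
      have h1 := hf j hj
      have h2 : B ^ (N + 1) * q ^ j - μ * B ^ N ≠ 0 := by
        rw [show B ^ (N + 1) * q ^ j - μ * B ^ N = B ^ N * (B * q ^ j - μ) by ring]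
        refine mul_ne_zero (pow_ne_zero _ hB) (sub_ne_zero.2 ?_)
        simpa using (hμ j).symm
      simpa [h2, hδ] using h1
    -- With f 0 j = 0, each e-term is Xʲ times a linear polynomial with leading coefficient (μq⁻ʲ -
    -- B)β ≠ 0.
    have he0 : ∀ j < N + 1, e 0 j = 0 := by
      have h1 : ∀ j < N + 1, e 0 j * δ ^ (N - j) = 0 := by
        apply eq_zero_of_sum_mul_linear_eq_zero (fun j => (μ * q⁻¹ ^ j - B) * β)
          (fun j => 1 - (μ * q⁻¹ ^ j - B) * β)
        · intro j
          refine mul_ne_zero (sub_ne_zero.2 fun h0 => hμ j ?_) hβ0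
          rw [← h0, zpow_natCast, inv_pow, inv_mul_cancel_right₀ (pow_ne_zero _ hq)]
        · rw [Finset.sum_eq_zero, zero_add] at hφ
          · rw [← hφ]
            refine Finset.sum_congr rfl fun j _ => ?_
            rw [← hv]
            simp only [map_mul, map_pow]
            ring
          · intro j hj
            rw [hf0 j (Finset.mem_range.1 hj)]; simp
      intro j hj
      simpa [hδ] using h1 j hj
    rw [Finset.sum_eq_zero, Finset.sum_eq_zero, zero_add, zero_add] at h
    · have hc : crossForm K ≠ 0 := mul_ne_zero (MvPolynomial.X_ne_zero _) (MvPolynomial.X_ne_zero _)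
      -- The condition μ ≠ Bqⁿ ranges over all integers n so that it passes to μ/q.
      obtain ⟨h1, h2⟩ := ih (μ * q⁻¹) _ _ (fun n h0 => hμ (n + 1) (by
        rw [zpow_add₀ hq, zpow_one, ← mul_assoc, ← h0, inv_mul_cancel_right₀ hq]))
        ((mul_eq_zero.1 h).resolve_left hc)
      constructor
      · rintro (_ | i) j hij
        · exact hf0 j (by omega)
        · exact h1 i j (by omega)
      · rintro (_ | i) j hij
        · exact he0 j (by omega)
        · exact h2 i j (by omega)
    · intro j hj; rw [he0 j (Finset.mem_range.1 hj)]; simp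
    · intro j hj; rw [hf0 j (Finset.mem_range.1 hj)]; simp

end Independence


/-! ### Dimension bound for glued forms, and spanning. -/

section Span

variable {K : Type*} [Field K]

theorem IsBihomogeneous.degrees {R : Type*} [CommSemiring R] {p : MvPolynomial Coord R} {k : ℕ}
    (hp : IsBihomogeneous p k) {d : Coord →₀ ℕ} (hd : MvPolynomial.coeff d p ≠ 0) :
    d (Sum.inl 0) + d (Sum.inl 1) = k ∧ d (Sum.inr 0) + d (Sum.inr 1) = k := by
  have h := hp hd
  rw [Finsupp.weight_apply, Finsupp.sum_fintype _ _ (by simp)] at h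
  simpa [Fintype.sum_sum_type, Fin.sum_univ_two, Prod.ext_iff] using h

/-- The bihomogeneous polynomials of bidegree `(k, k)` with `p (1, 0, t) = ν p (t, 0, 1)`. -/
def gluedForms (k : ℕ) (ν : K) : Submodule K (MvPolynomial Coord K) where
  carrier := {p | IsBihomogeneous p k ∧ ∀ t : Fin 2 → K,
    MvPolynomial.eval (Sum.elim ![1, 0] t) p = ν * MvPolynomial.eval (Sum.elim t ![0, 1]) p}
  add_mem' := by
    rintro p r ⟨hp, hp'⟩ ⟨hr, hr'⟩
    exact ⟨hp.add hr, fun t => by rw [map_add, map_add, hp', hr']; ring⟩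
  zero_mem' := ⟨MvPolynomial.isWeightedHomogeneous_zero _ _ _, fun t => by simp⟩
  smul_mem' := by
    rintro a p ⟨hp, hp'⟩
    refine ⟨?_, fun t => by rw [MvPolynomial.smul_eval, MvPolynomial.smul_eval, hp']; ring⟩
    rw [MvPolynomial.smul_eq_C_mul]
    simpa [IsBihomogeneous] using (MvPolynomial.isWeightedHomogeneous_C _ a).mul hp

theorem gluedForms_mul {k l : ℕ} {ν ν' : K} {p r : MvPolynomial Coord K}
    (hp : p ∈ gluedForms k ν) (hr : r ∈ gluedForms l ν') : p * r ∈ gluedForms (k + l) (ν * ν') :=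
  ⟨hp.1.mul hr.1, fun t => by rw [map_mul, map_mul, hp.2, hr.2]; ring⟩

theorem one_mem_gluedForms : (1 : MvPolynomial Coord K) ∈ gluedForms 0 (1 : K) :=
  ⟨MvPolynomial.isWeightedHomogeneous_one _ _, fun t => by simp⟩

theorem gluedForms_pow {k : ℕ} {ν : K} {p : MvPolynomial Coord K}
    (hp : p ∈ gluedForms k ν) (n : ℕ) : p ^ n ∈ gluedForms (n * k) (ν ^ n) := by
  induction n with
  | zero => simpa using one_mem_gluedForms
  | succ n ih =>
    rw [pow_succ, pow_succ, Nat.succ_mul]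
    exact gluedForms_mul ih hp

theorem isBihomogeneous_monomial (a : K) (i j : Fin 2) :
    IsBihomogeneous (MvPolynomial.C a * MvPolynomial.X (Sum.inl i) * MvPolynomial.X (Sum.inr j))
      1 := by
  have := ((MvPolynomial.isWeightedHomogeneous_C
    (Sum.elim (fun _ => (1, 0)) (fun _ => (0, 1)) : Coord → ℕ × ℕ) a).mul
    (MvPolynomial.isWeightedHomogeneous_X K _ (Sum.inl i))).mul
    (MvPolynomial.isWeightedHomogeneous_X K _ (Sum.inr j))
  simpa [IsBihomogeneous] using this

theorem crossForm_mem_gluedForms (t : K) : crossForm K ∈ gluedForms 1 t :=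
  ⟨by simpa [crossForm] using isBihomogeneous_monomial (1 : K) 1 0, fun u => by simp [crossForm]⟩

theorem glueForm_mem_gluedForms (t : K) : glueForm t ∈ gluedForms 1 t := by
  refine ⟨((isBihomogeneous_monomial _ 0 0).add (isBihomogeneous_monomial _ 0 1)).add
    (by simpa [IsBihomogeneous] using isBihomogeneous_monomial (1 : K) 1 1), fun u => ?_⟩
  simp [glueForm]; ring

/-- The coefficients of `z₁ᵏ⁻¹⁻ⁱ z₂ⁱ⁺¹ w₁ᵏ⁻ʲ w₂ʲ`. -/
def upperCoeffs (K : Type*) [Field K] (k : ℕ) :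
    MvPolynomial Coord K →ₗ[K] (Fin k × Fin (k + 1) → K) :=
  LinearMap.pi fun x => MvPolynomial.lcoeff K (Finsupp.equivFunOnFinite.symm
    (Sum.elim ![k - 1 - x.1, (x.1 : ℕ) + 1] ![k - x.2, (x.2 : ℕ)]))

/-- Only monomials with z₁ᵏ are left, so p = z₁ᵏ p(1, 0, w). Gluing gives p(1, 0, 0, 1) = ν p(0, 1,
0, 1) = 0 since k ≠ 0, and then p(1, 0, t) = ν t₁ᵏ p(1, 0, 0, 1) = 0. -/
theorem eq_zero_of_upperCoeffs_eq_zero [Infinite K] {k : ℕ} (hk : k ≠ 0) {ν : K}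
    {p : MvPolynomial Coord K} (hp : p ∈ gluedForms k ν) (h : upperCoeffs K k p = 0) : p = 0 := by
  have h0 : ∀ d ∈ p.support, d (Sum.inl 0) = k ∧ d (Sum.inl 1) = 0 := by
    intro d hd
    rw [MvPolynomial.mem_support_iff] at hd
    obtain ⟨h1, h2⟩ := hp.1.degrees hd
    by_contra hne
    have h3 : d (Sum.inl 1) ≠ 0 := fun h3 => hne ⟨by omega, h3⟩
    refine hd ?_
    have h4 := congrFun h (⟨d (Sum.inl 1) - 1, by omega⟩, ⟨d (Sum.inr 1), by omega⟩)
    rw [Pi.zero_apply] at h4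
    rw [← h4]
    simp only [upperCoeffs, LinearMap.pi_apply, MvPolynomial.lcoeff_apply]
    congr 1
    ext (i | i) <;> fin_cases i <;> simp <;> omega
  have h1 : ∀ z w : Fin 2 → K, MvPolynomial.eval (Sum.elim z w) p =
      z 0 ^ k * MvPolynomial.eval (Sum.elim ![1, 0] w) p := by
    intro z w
    rw [MvPolynomial.eval_eq', MvPolynomial.eval_eq', Finset.mul_sum]
    refine Finset.sum_congr rfl fun d hd => ?_
    obtain ⟨h2, h3⟩ := h0 d hd
    simp [Fintype.prod_sum_type, Fin.prod_univ_two, h2, h3]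
    ring
  have h2 : MvPolynomial.eval (Sum.elim (![1, 0] : Fin 2 → K) ![0, 1]) p = 0 := by
    rw [hp.2, h1]; simp [hk]
  have h3 : ∀ t : Fin 2 → K, MvPolynomial.eval (Sum.elim ![1, 0] t) p = 0 := by
    intro t
    rw [hp.2, h1, h2, mul_zero, mul_zero]
  refine MvPolynomial.funext fun x => ?_
  rw [map_zero, ← Sum.elim_comp_inl_inr x, h1, h3, mul_zero]

theorem upperCoeffs_injective [Infinite K] {k : ℕ} (hk : k ≠ 0) (ν : K) :
    Function.Injective ((upperCoeffs K k).comp (gluedForms k ν).subtype) := by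
  rw [← LinearMap.ker_eq_bot, LinearMap.ker_eq_bot']
  intro p hp
  exact Subtype.ext (eq_zero_of_upperCoeffs_eq_zero hk p.2 hp)

theorem finite_gluedForms [Infinite K] {k : ℕ} (hk : k ≠ 0) (ν : K) :
    Module.Finite K (gluedForms k ν) :=
  Module.Finite.of_injective _ (upperCoeffs_injective hk ν)

theorem finrank_gluedForms_le [Infinite K] {k : ℕ} (hk : k ≠ 0) (ν : K) :
    Module.finrank K (gluedForms k ν) ≤ k * (k + 1) := by
  have := LinearMap.finrank_le_finrank_of_injective (upperCoeffs_injective hk ν)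
  simpa using this

/-- The pairs `(i, j)` of natural numbers with `i + j ≤ N`. -/
def triangle (N : ℕ) : Finset (ℕ × ℕ) :=
  (Finset.range (N + 1) ×ˢ Finset.range (N + 1)).filter fun m => m.1 + m.2 ≤ N

theorem mem_triangle {N : ℕ} {m : ℕ × ℕ} : m ∈ triangle N ↔ m.1 + m.2 ≤ N := by
  simp only [triangle, Finset.mem_filter, Finset.mem_product, Finset.mem_range]
  omega

theorem sum_triangle {M : Type*} [AddCommMonoid M] (N : ℕ) (f : ℕ × ℕ → M) :
    ∑ m ∈ triangle N, f m =
      ∑ i ∈ Finset.range (N + 1), ∑ j ∈ Finset.range (N + 1 - i), f (i, j) := by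
  apply Finset.sum_finset_product
  intro m
  rw [mem_triangle, Finset.mem_range, Finset.mem_range]
  omega

theorem two_mul_card_triangle (N : ℕ) : 2 * (triangle N).card = (N + 1) * (N + 1 + 1) := by
  rw [Finset.card_eq_sum_ones, sum_triangle]
  simp only [Finset.sum_const, Finset.card_range, smul_eq_mul, mul_one]
  induction N with
  | zero => simp
  | succ N ih =>
    rw [Finset.sum_range_succ', mul_add]
    simp only [Nat.add_sub_add_right]
    rw [ih, Nat.sub_zero]
    ring

/-- The product `cⁱ vʲ Gᴺ⁻ⁱ⁻ʲ`, `m = (i, j)`, with a further factor `c` or `v_{μ q⁻ⁱ⁻ʲ}`, where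
`c = z₂w₁`, `v = v_{Bq}` and `G = δ v_B + γ c`. -/
def formFamily (B q δ γ μ : K) (N : ℕ) (x : Fin 2 × ℕ × ℕ) : MvPolynomial Coord K :=
  (![crossForm K, glueForm (μ * q⁻¹ ^ (x.2.1 + x.2.2))] : Fin 2 → MvPolynomial Coord K) x.1 *
    (crossForm K ^ x.2.1 * glueForm (B * q) ^ x.2.2 *
      (MvPolynomial.C δ * glueForm B + MvPolynomial.C γ * crossForm K) ^ (N - x.2.1 - x.2.2))

variable {B q δ γ μ : K}

theorem eq_zero_of_sum_formFamily_eq_zero (hB : B ≠ 0) (hq : q ≠ 0) (hq1 : q ≠ 1) (hδ : δ ≠ 0)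
    (hμ : ∀ n : ℤ, μ ≠ B * q ^ n) (N : ℕ) (a : Fin 2 × ℕ × ℕ → K)
    (h : ∑ x ∈ Finset.univ ×ˢ triangle N, a x • formFamily B q δ γ μ N x = 0) :
    ∀ x ∈ Finset.univ ×ˢ triangle N, a x = 0 := by
  -- The products with the further factor c are the f-terms of level N + 1 with i raised by one;
  -- hence the row i = 0 of f is zero.
  have key := formSum_eq_zero (γ := γ) hB hq hq1 hδ (N + 1) μ
    (fun i j => if i = 0 then 0 else a (0, i - 1, j)) (fun i j => a (1, i, j)) hμ (by
      rw [← h, Finset.sum_product, Fin.sum_univ_two, sum_triangle, sum_triangle]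
      unfold formSum
      congr 1
      · rw [Finset.sum_range_succ']
        simp only [Nat.add_sub_add_right, if_true, map_zero, zero_mul, Finset.sum_const_zero,
          add_zero, Nat.add_eq_zero_iff, one_ne_zero, and_false, if_false, Nat.add_sub_cancel]
        refine Finset.sum_congr rfl fun i _ => Finset.sum_congr rfl fun j _ => ?_
        rw [MvPolynomial.smul_eq_C_mul]
        simp only [formFamily, Matrix.cons_val_zero]
        ring
      · refine Finset.sum_congr rfl fun i _ => Finset.sum_congr rfl fun j _ => ?_
        rw [MvPolynomial.smul_eq_C_mul]
        simp only [formFamily, Matrix.cons_val_one, Nat.add_sub_cancel]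
        rfl)
  rintro ⟨b, i, j⟩ hx
  have hij : i + j ≤ N := mem_triangle.1 (Finset.mem_product.1 hx).2
  fin_cases b
  · simpa using key.1 (i + 1) j (by omega)
  · exact key.2 i j (by omega)

theorem formFamily_mem_gluedForms (hq : q ≠ 0) (N : ℕ) {x : Fin 2 × ℕ × ℕ}
    (hx : x ∈ Finset.univ ×ˢ triangle N) :
    formFamily B q δ γ μ N x ∈ gluedForms (N + 1) (μ * B ^ N) := by
  obtain ⟨b, i, j⟩ := x
  obtain ⟨l, hl⟩ := Nat.exists_eq_add_of_le (mem_triangle.1 (Finset.mem_product.1 hx).2)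
  have hG : MvPolynomial.C δ * glueForm B + MvPolynomial.C γ * crossForm K ∈ gluedForms 1 B := by
    rw [← MvPolynomial.smul_eq_C_mul, ← MvPolynomial.smul_eq_C_mul]
    exact add_mem (Submodule.smul_mem _ _ (glueForm_mem_gluedForms B))
      (Submodule.smul_mem _ _ (crossForm_mem_gluedForms B))
  have h0 : (![crossForm K, glueForm (μ * q⁻¹ ^ (i + j))] : Fin 2 → MvPolynomial Coord K) b ∈
      gluedForms 1 (μ * q⁻¹ ^ (i + j)) := by
    fin_cases b
    · exact crossForm_mem_gluedForms _
    · exact glueForm_mem_gluedForms _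
  have hij : N = i + j + l := hl
  have hl' : N - i - j = l := by omega
  have hdeg : 1 + (i * 1 + j * 1 + l * 1) = N + 1 := by omega
  -- As c vanishes on both curves it is glued with any factor: Bq is used for the i powers of c, and
  -- μq^(-i-j) for the further factor. The total is then independent of i and j.
  have hν : μ * q⁻¹ ^ (i + j) * ((B * q) ^ i * (B * q) ^ j * B ^ l) = μ * B ^ N := by
    rw [hij, mul_pow, mul_pow, inv_pow, pow_add, pow_add, pow_add]
    field_simp
  have := gluedForms_mul h0 (gluedForms_mul (gluedForms_mul
    (gluedForms_pow (crossForm_mem_gluedForms (B * q)) i)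
    (gluedForms_pow (glueForm_mem_gluedForms (B * q)) j)) (gluedForms_pow hG l))
  rw [hdeg, hν] at this
  rwa [formFamily, hl']

/-- A dimension count: the family is independent, lies in the glued forms, and its size 2 · card
(`triangle` N) = (N+1)(N+2) is the upper bound for their dimension. -/
theorem exists_eq_sum_formFamily [Infinite K] (hB : B ≠ 0) (hq : q ≠ 0) (hq1 : q ≠ 1) (hδ : δ ≠ 0)
    (hμ : ∀ n : ℤ, μ ≠ B * q ^ n) (N : ℕ) {p : MvPolynomial Coord K}
    (hp : p ∈ gluedForms (N + 1) (μ * B ^ N)) :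
    ∃ a : Fin 2 × ℕ × ℕ → K,
      ∑ x ∈ Finset.univ ×ˢ triangle N, a x • formFamily B q δ γ μ N x = p := by
  refine (Submodule.mem_span_image_finset_iff_exists_fun' K).1 ?_
  have hli : LinearIndepOn K (formFamily B q δ γ μ N)
      ((Finset.univ ×ˢ triangle N : Finset (Fin 2 × ℕ × ℕ)) : Set (Fin 2 × ℕ × ℕ)) :=
    linearIndepOn_finset_iff.2 (eq_zero_of_sum_formFamily_eq_zero hB hq hq1 hδ hμ N)
  have hfin := finite_gluedForms N.succ_ne_zero (μ * B ^ N)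
  have hle : Submodule.span K (formFamily B q δ γ μ N ''
      ((Finset.univ ×ˢ triangle N : Finset (Fin 2 × ℕ × ℕ)) : Set (Fin 2 × ℕ × ℕ))) ≤ gluedForms (N + 1) (μ * B ^ N) := by
    rw [Submodule.span_le]
    rintro _ ⟨x, hx, rfl⟩
    exact formFamily_mem_gluedForms hq N hx
  rw [Submodule.eq_of_le_of_finrank_le hle]
  · exact hp
  · refine (finrank_gluedForms_le N.succ_ne_zero _).trans ?_
    have h1 := finrank_span_eq_card hli
    rw [Set.image_eq_range]
    refine le_trans (le_of_eq ?_) h1.ge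
    rw [← Set.toFinset_card, Finset.toFinset_coe, Finset.card_product, Finset.card_univ, Fintype.card_fin,
      two_mul_card_triangle]

end Span


/-! ### Glued forms and their restrictions to the two curves. -/

section Forms

variable {R : Type} [Field R]

/-- Testing the gluing at t = (1, 0) and t = (0, 1) gives a₀₀ = c a₀₁ and a₀₁ = c a₁₁; a₁₁ and a₁₀
stay free. -/
theorem formPoly_eq [Algebra ℂ R] {a : Fin 2 → Fin 2 → ℂ} {c : ℂ}
    (ha : ∀ t : Fin 2 → ℂ, evalForm a ![1, 0] t = c * evalForm a t ![0, 1]) :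
    formPoly R a = MvPolynomial.C (algebraMap ℂ R (a 1 1)) * glueForm (algebraMap ℂ R c) +
      MvPolynomial.C (algebraMap ℂ R (a 1 0)) * crossForm R := by
  have h0 : a 0 0 = c * a 0 1 := by simpa [evalForm] using ha ![1, 0]
  have h1 : a 0 1 = c * a 1 1 := by simpa [evalForm] using ha ![0, 1]
  simp only [formPoly, Fin.sum_univ_two, glueForm, crossForm, h0, h1, map_mul, map_pow]
  ring

variable {S : Type} [Field S] (φ : R →+* S)

theorem map_crossForm : MvPolynomial.map φ (crossForm R) = crossForm S := by
  simp [crossForm]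

theorem map_glueForm (t : R) : MvPolynomial.map φ (glueForm t) = glueForm (φ t) := by
  simp [glueForm]

end Forms

theorem eval_aeval {R : Type*} [CommRing R] (t : Fin 2 → R) (x : Coord → MvPolynomial (Fin 2) R)
    (p : MvPolynomial Coord R) : MvPolynomial.eval t (MvPolynomial.aeval x p) =
      MvPolynomial.eval (fun i => MvPolynomial.eval t (x i)) p := by
  rw [MvPolynomial.aeval_def, ← MvPolynomial.coe_eval₂Hom, MvPolynomial.eval,
    MvPolynomial.coe_eval₂Hom, ← MvPolynomial.coe_eval₂Hom, ← RingHom.comp_apply]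
  congr 1
  ext <;> simp

theorem eval_aeval_fst {R : Type*} [CommRing R] (t : Fin 2 → R) (p : MvPolynomial Coord R) :
    MvPolynomial.eval t (MvPolynomial.aeval (Sum.elim ![1, 0] MvPolynomial.X) p) =
      MvPolynomial.eval (Sum.elim ![1, 0] t) p := by
  rw [eval_aeval]
  congr 2
  ext (i | i)
  · fin_cases i <;> simp
  · simp

theorem eval_aeval_snd {R : Type*} [CommRing R] (t : Fin 2 → R) (p : MvPolynomial Coord R) :
    MvPolynomial.eval t (MvPolynomial.aeval (Sum.elim MvPolynomial.X ![0, 1]) p) =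
      MvPolynomial.eval (Sum.elim t ![0, 1]) p := by
  rw [eval_aeval]
  congr 2
  ext (i | i)
  · simp
  · fin_cases i <;> simp

theorem restrictFst_crossForm : restrictFst (crossForm Coeff) = 0 := by
  simp [restrictFst, crossForm]

theorem restrictSnd_crossForm : restrictSnd (crossForm Coeff) = 0 := by
  simp [restrictSnd, crossForm]

theorem restrictFst_glueForm (t : Coeff) :
    restrictFst (glueForm t) = algebraMap Coeff LineField t * restrictSnd (glueForm t) := by
  rw [IsScalarTower.algebraMap_apply Coeff (MvPolynomial (Fin 2) Coeff) LineField]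
  simp only [restrictFst, restrictSnd, glueForm, RingHom.comp_apply, ← map_mul]
  congr 1
  simp [MvPolynomial.algebraMap_eq]
  ring

theorem restrictFst_formPoly {a : Fin 2 → Fin 2 → ℂ} {c : ℂ}
    (ha : ∀ t : Fin 2 → ℂ, evalForm a ![1, 0] t = c * evalForm a t ![0, 1]) :
    restrictFst (formPoly Coeff a) =
      algebraMap Coeff LineField (algebraMap ℂ Coeff c) * restrictSnd (formPoly Coeff a) := by
  simp only [formPoly_eq ha, map_add, map_mul, restrictFst_crossForm, restrictSnd_crossForm,
    restrictFst_glueForm, OmegaData.restrict_C]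
  ring

/-! ### Action of difference operators on numerators. -/

namespace OmegaData

variable (F : OmegaData) (h : Fin 2 → ℂ)

/-- The discrete function `n ↦ p(n, P) / g(P) ^ k * ∏ j, (gⱼ(P) / g(P)) ^ nⱼ`. -/
def val (k : ℕ) (p : MvPolynomial Coord Coeff) : DiscreteFun :=
  F.value h (algebraMap _ ValueField) k p

theorem shift_zero : F.shift h 0 = RingHom.id Coeff := by
  apply expScale_ext
  · intro c; simp [shift, expScale_C]
  · simp [shift, expScale_X]

theorem val_apply_zero (k : ℕ) (p : MvPolynomial Coord Coeff) :
    F.val h k p 0 = algebraMap _ ValueField p / algebraMap _ ValueField (formPoly Coeff F.g) ^ k := by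
  simp [val, value, shift_zero, MvPolynomial.map_id]

theorem val_add (k : ℕ) (p r : MvPolynomial Coord Coeff) :
    F.val h k (p + r) = F.val h k p + F.val h k r :=
  funext fun n => F.value_add h _ k p r n

theorem val_zero (k : ℕ) : F.val h k 0 = 0 := by
  funext n
  simp [val, value]

theorem val_sum {ι : Type*} (k : ℕ) (t : Finset ι) (p : ι → MvPolynomial Coord Coeff) :
    F.val h k (∑ i ∈ t, p i) = ∑ i ∈ t, F.val h k (p i) :=
  map_sum (⟨⟨F.val h k, F.val_zero h k⟩, F.val_add h k⟩ : MvPolynomial Coord Coeff →+ DiscreteFun)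
    p t

theorem val_raise (k l : ℕ) (p : MvPolynomial Coord Coeff) :
    F.val h (k + l) (p * formPoly Coeff F.g ^ l) = F.val h k p :=
  funext fun n => F.value_raise h _ (formPoly_ne _ F.g_ne) k l p n

theorem mulHat_val (k : ℕ) (f : Coeff) (p : MvPolynomial Coord Coeff) :
    F.mulHat h f (F.val h k p) = F.val h k (MvPolynomial.C f * p) := by
  funext n
  refine Eq.trans ?_ (F.value_coeff h _ k f p n).symm
  rw [← MvPolynomial.algebraMap_eq, ← IsScalarTower.algebraMap_apply]
  rfl

theorem opT_val (hadm : F.Admissible h) (i : Fin 2) (k : ℕ) (p : MvPolynomial Coord Coeff) :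
    opT i (F.val h k p) = F.val h (k + 1) (formPoly Coeff (F.gi h i) *
      MvPolynomial.map (F.shift h (Pi.single i 1)) p) :=
  funext fun n => (F.value_shift h _ (formPoly_ne _ F.g_ne) i (formPoly_ne _ (hadm i).2) k p n).symm

theorem mulHat_mul (f g : Coeff) : F.mulHat h f * F.mulHat h g = F.mulHat h (f * g) := by
  ext1 ψ
  funext n
  change algebraMap Coeff ValueField _ * (algebraMap Coeff ValueField _ * ψ n) =
    algebraMap Coeff ValueField _ * ψ n
  rw [map_mul, map_mul, mul_assoc]

theorem mulHat_add (f g : Coeff) : F.mulHat h (f + g) = F.mulHat h f + F.mulHat h g := by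
  ext1 ψ
  funext n
  change algebraMap Coeff ValueField _ * ψ n =
    algebraMap Coeff ValueField _ * ψ n + algebraMap Coeff ValueField _ * ψ n
  rw [map_add, map_add, add_mul]

theorem mulHat_algebraMap (c : ℂ) :
    F.mulHat h (algebraMap ℂ Coeff c) = algebraMap ℂ (Module.End ℂ DiscreteFun) c := by
  ext1 ψ
  funext n
  change algebraMap Coeff ValueField (expScale _ (algebraMap ℂ Coeff c)) * ψ n = c • ψ n
  rw [expScale_algebraMap, ← IsScalarTower.algebraMap_apply, Algebra.smul_def]

theorem opT_mul_mulHat (i : Fin 2) (f : Coeff) :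
    opT i * F.mulHat h f = F.mulHat h (F.shift h (Pi.single i 1) f) * opT i := by
  ext1 ψ
  funext n
  change algebraMap Coeff ValueField (F.shift h (n + Pi.single i 1) f) * ψ (n + Pi.single i 1) =
    algebraMap Coeff ValueField (F.shift h n (F.shift h (Pi.single i 1) f)) * ψ (n + Pi.single i 1)
  rw [shift_add]
  rfl

theorem opT_comm (i j : Fin 2) : opT i * opT j = opT j * opT i := by
  ext1 ψ
  funext n
  change ψ (n + Pi.single i 1 + Pi.single j 1) = ψ (n + Pi.single j 1 + Pi.single i 1)
  rw [add_right_comm]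

/-- The multiplier `BΛ e^(-(c̃₁x₁ + c̃₂x₂))` of the numerators of the elements of the first piece. -/
def mult : Coeff := RatFunc.C (F.B * F.Λ) * RatFunc.X⁻¹

theorem mult_mul_pow (k : ℕ) :
    F.mult * algebraMap ℂ Coeff F.B ^ k = RatFunc.C F.B ^ (k + 1) * (RatFunc.C F.Λ * RatFunc.X⁻¹) := by
  rw [mult, RatFunc.algebraMap_eq_C, map_mul]
  ring

/-- The multiplier is a nonzero multiple of X⁻¹, hence not constant. This supplies the condition μ ≠
Bqⁿ. -/
theorem mult_ne (c : ℂ) : F.mult ≠ algebraMap ℂ Coeff c := by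
  intro h0
  rw [mult, RatFunc.algebraMap_eq_C, ← div_eq_mul_inv, div_eq_iff RatFunc.X_ne_zero] at h0
  have h1 : algebraMap (Polynomial ℂ) Coeff (Polynomial.C (F.B * F.Λ)) =
      algebraMap (Polynomial ℂ) Coeff (Polynomial.C c * Polynomial.X) := by
    simpa using h0
  have h2 := congrArg (Polynomial.eval 0) (RatFunc.algebraMap_injective ℂ h1)
  simp [F.B_ne, F.Λ_ne] at h2

/-- At n = 0 the shift and the product of the gⱼ/g are trivial, so the gluing condition on ψ becomes
one on p, with Bᵏ coming from the denominator gᵏ. -/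
theorem mem_gluedForms_of_value {k : ℕ} {p : MvPolynomial Coord Coeff} (hp : IsBihomogeneous p k)
    (h0 : F.value h restrictFst k p 0 = F.multiplier * F.value h restrictSnd k p 0) :
    p ∈ gluedForms k (RatFunc.C F.B ^ k * (RatFunc.C F.Λ * RatFunc.X⁻¹)) := by
  refine ⟨hp, fun t => ?_⟩
  have hg := restrictSnd_ne _ F.g_ne
  have hB : algebraMap Coeff LineField (algebraMap ℂ Coeff F.B) ≠ 0 := by
    simp [F.B_ne]
  simp only [value, shift_zero, MvPolynomial.map_id, Pi.zero_apply, zpow_zero, Finset.prod_const_one,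
    mul_one, restrictFst_formPoly F.g_glue, multiplier] at h0
  rw [div_eq_iff (pow_ne_zero _ (mul_ne_zero hB hg)), mul_pow] at h0
  have h1 : restrictFst p = algebraMap Coeff LineField
      (RatFunc.C F.B ^ k * (RatFunc.C F.Λ * RatFunc.X⁻¹)) * restrictSnd p := by
    rw [h0, map_mul (algebraMap Coeff LineField) (RatFunc.C F.B ^ k), map_pow,
      RatFunc.algebraMap_eq_C]
    rw [RatFunc.algebraMap_eq_C] at hB
    field_simp
  rw [IsScalarTower.algebraMap_apply Coeff (MvPolynomial (Fin 2) Coeff) LineField] at h1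
  simp only [restrictFst, restrictSnd, RingHom.comp_apply, ← map_mul] at h1
  have h2 := congrArg (MvPolynomial.eval t) (IsFractionRing.injective _ LineField h1)
  change MvPolynomial.eval t (MvPolynomial.aeval _ p) =
    MvPolynomial.eval t (_ * MvPolynomial.aeval _ p) at h2
  rwa [map_mul, eval_aeval_fst, eval_aeval_snd, MvPolynomial.algebraMap_eq,
    MvPolynomial.eval_C] at h2

end OmegaData
-- Diagonal parameters: normal forms of operators and freeness.
namespace OmegaData

/-- Parameters `h` with `c̃₁h₁ = c̃₂h₂ = s`, `e^s ≠ 1`, for which `g₁`, `g₂` do not vanish on the glued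
curves and are linearly independent. -/
structure IsDiagonal (F : OmegaData) (h : Fin 2 → ℂ) (s : ℂ) : Prop where
  ct_mul : ∀ i, F.ct i * h i = s
  exp_ne_one : Complex.exp s ≠ 1
  gi_ne : ∀ i, F.gi h i 1 1 ≠ 0
  det_ne : F.gi h 0 1 1 * F.gi h 1 1 0 - F.gi h 1 1 1 * F.gi h 0 1 0 ≠ 0

variable {F : OmegaData} {h : Fin 2 → ℂ} {s : ℂ}

theorem IsDiagonal.admissible (H : F.IsDiagonal h s) : F.Admissible h := by
  intro i
  refine ⟨fun h0 => H.exp_ne_one ?_, by rw [evalForm_zero_one]; exact H.gi_ne i⟩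
  rw [← H.ct_mul i, h0, mul_zero, Complex.exp_zero]

theorem IsDiagonal.shift_single (H : F.IsDiagonal h s) (i : Fin 2) :
    F.shift h (Pi.single i 1) = expScale s := by
  rw [shift]
  congr 1
  have := H.ct_mul i
  fin_cases i <;> simpa [Fin.sum_univ_two] using this

theorem IsDiagonal.formPoly_gi (H : F.IsDiagonal h s) (i : Fin 2) :
    formPoly Coeff (F.gi h i) =
      MvPolynomial.C (algebraMap ℂ Coeff (F.gi h i 1 1)) *
        glueForm (algebraMap ℂ Coeff F.B * algebraMap ℂ Coeff (Complex.exp s)) +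
      MvPolynomial.C (algebraMap ℂ Coeff (F.gi h i 1 0)) * crossForm Coeff := by
  have hg : ∀ t : Fin 2 → ℂ, evalForm (F.gi h i) ![1, 0] t =
      (F.B * Complex.exp s) * evalForm (F.gi h i) t ![0, 1] := by
    have := F.G_glue i (F.ct i * h i)
    rw [H.ct_mul i] at this
    rw [gi, H.ct_mul i]
    exact this
  rw [formPoly_eq hg, map_mul]

theorem expScale_mult (F : OmegaData) (a : ℂ) :
    expScale a F.mult = F.mult * (algebraMap ℂ Coeff (Complex.exp a))⁻¹ := by
  rw [mult, map_mul, map_inv₀, expScale_X, expScale_C, RatFunc.algebraMap_eq_C, mul_inv]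
  ring

/-- The numerators `z₂w₁` and `v_μ` of the basis, shifted by `m`. -/
def basisForm (F : OmegaData) (s : ℂ) (b : Fin 2) (m : ℕ) : MvPolynomial Coord Coeff :=
  (![crossForm Coeff, glueForm (F.mult * (algebraMap ℂ Coeff (Complex.exp s))⁻¹ ^ m)] :
    Fin 2 → MvPolynomial Coord Coeff) b

theorem map_basisForm (b : Fin 2) (m : ℕ) :
    MvPolynomial.map (expScale s) (F.basisForm s b m) = F.basisForm s b (m + 1) := by
  fin_cases b
  · exact map_crossForm _
  · change MvPolynomial.map (expScale s) (glueForm _) = glueForm _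
    rw [map_glueForm, map_mul, map_pow, map_inv₀, expScale_mult, expScale_algebraMap, pow_succ]
    congr 1
    ring

variable (F h) in
/-- The operator acting on numerators as multiplication by `z₂w₁` and a shift. -/
def crossOp : Module.End ℂ DiscreteFun :=
  (F.gi h 0 1 1 * F.gi h 1 1 0 - F.gi h 1 1 1 * F.gi h 0 1 0)⁻¹ •
    (F.gi h 0 1 1 • opT 1 - F.gi h 1 1 1 • opT 0)

variable (F h) in
/-- The operator acting on numerators as multiplication by `v_{Bq}` and a shift. -/
def glueOp : Module.End ℂ DiscreteFun :=
  (F.gi h 0 1 1 * F.gi h 1 1 0 - F.gi h 1 1 1 * F.gi h 0 1 0)⁻¹ •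
    (F.gi h 1 1 0 • opT 0 - F.gi h 0 1 0 • opT 1)

theorem opT_mem (i : Fin 2) : opT i ∈ F.T2 h :=
  Algebra.subset_adjoin (Or.inr ⟨i, rfl⟩)

theorem crossOp_mem : F.crossOp h ∈ F.T2 h :=
  (F.T2 h).smul_mem ((F.T2 h).sub_mem ((F.T2 h).smul_mem (opT_mem _) _)
    ((F.T2 h).smul_mem (opT_mem _) _)) _

theorem glueOp_mem : F.glueOp h ∈ F.T2 h :=
  (F.T2 h).smul_mem ((F.T2 h).sub_mem ((F.T2 h).smul_mem (opT_mem _) _)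
    ((F.T2 h).smul_mem (opT_mem _) _)) _

theorem mulHat_mem (f : Coeff) : F.mulHat h f ∈ F.T2 h :=
  Algebra.subset_adjoin (Or.inl ⟨f, rfl⟩)

/-- `crossOp` and `glueOp` are obtained by Cramer's rule from this pair of equations, which mirrors
the expansion of gᵢ in v_{Bq} and c. -/
theorem IsDiagonal.opT_eq (H : F.IsDiagonal h s) (i : Fin 2) :
    (opT i : Module.End ℂ DiscreteFun) =
      F.gi h i 1 1 • F.glueOp h + F.gi h i 1 0 • F.crossOp h := by
  have hd := inv_mul_cancel₀ H.det_ne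
  rw [glueOp, crossOp]
  set I := (F.gi h 0 1 1 * F.gi h 1 1 0 - F.gi h 1 1 1 * F.gi h 0 1 0)⁻¹
  calc (opT i : Module.End ℂ DiscreteFun)
      = (I * (F.gi h 0 1 1 * F.gi h 1 1 0 - F.gi h 1 1 1 * F.gi h 0 1 0)) • opT i := by
        rw [hd, one_smul]
    _ = _ := by
        fin_cases i
        · simp only [Fin.zero_eta]
          module
        · simp only [Fin.mk_one]
          module

theorem glueOp_mul_crossOp : F.glueOp h * F.crossOp h = F.crossOp h * F.glueOp h := by
  simp only [glueOp, crossOp, smul_mul_smul_comm, mul_sub, sub_mul, opT_comm 1 0]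
  module

theorem smul_eq_mulHat_mul (c : ℂ) (D : Module.End ℂ DiscreteFun) :
    c • D = F.mulHat h (algebraMap ℂ Coeff c) * D := by
  rw [mulHat_algebraMap, Algebra.smul_def]

theorem IsDiagonal.crossOp_mul_mulHat (H : F.IsDiagonal h s) (f : Coeff) :
    F.crossOp h * F.mulHat h f = F.mulHat h (expScale s f) * F.crossOp h := by
  simp only [crossOp, smul_mul_assoc, sub_mul, opT_mul_mulHat, H.shift_single, mul_smul_comm,
    mul_sub]

theorem IsDiagonal.glueOp_mul_mulHat (H : F.IsDiagonal h s) (f : Coeff) :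
    F.glueOp h * F.mulHat h f = F.mulHat h (expScale s f) * F.glueOp h := by
  simp only [glueOp, smul_mul_assoc, sub_mul, opT_mul_mulHat, H.shift_single, mul_smul_comm,
    mul_sub]

variable (F h) in
/-- The operator with normal form `∑ f i j Uⁱ Vʲ`, where `U` and `V` are `crossOp` and `glueOp`. -/
def normalOp : ((ℕ × ℕ) →₀ Coeff) →+ Module.End ℂ DiscreteFun :=
  Finsupp.liftAddHom fun m =>
    { toFun := fun a => F.mulHat h a * (F.crossOp h ^ m.1 * F.glueOp h ^ m.2)
      map_zero' := by
        have := F.mulHat_algebraMap h 0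
        rw [map_zero, map_zero] at this
        rw [this, zero_mul]
      map_add' := fun a b => by rw [mulHat_add, add_mul] }

theorem normalOp_single (m : ℕ × ℕ) (a : Coeff) : F.normalOp h (Finsupp.single m a) =
    F.mulHat h a * (F.crossOp h ^ m.1 * F.glueOp h ^ m.2) := by
  rw [normalOp, Finsupp.liftAddHom_apply_single]
  rfl

theorem mul_mem_range_normalOp {D : Module.End ℂ DiscreteFun}
    (hD : ∀ m a, D * (F.mulHat h a * (F.crossOp h ^ (m : ℕ × ℕ).1 * F.glueOp h ^ m.2)) ∈
      (F.normalOp h).range) {E : Module.End ℂ DiscreteFun} (hE : E ∈ (F.normalOp h).range) :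
    D * E ∈ (F.normalOp h).range := by
  obtain ⟨f, rfl⟩ := hE
  induction f using Finsupp.induction_linear with
  | zero => rw [map_zero, mul_zero]; exact zero_mem _
  | add f g hf hg => rw [map_add, mul_add]; exact add_mem hf hg
  | single m a => rw [normalOp_single]; exact hD m a

theorem mulHat_mul_mem_range_normalOp (f : Coeff) {E : Module.End ℂ DiscreteFun}
    (hE : E ∈ (F.normalOp h).range) : F.mulHat h f * E ∈ (F.normalOp h).range := by
  refine mul_mem_range_normalOp (fun m a => ⟨Finsupp.single m (f * a), ?_⟩) hE
  rw [normalOp_single, ← mulHat_mul, mul_assoc]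

theorem IsDiagonal.opT_mul_mem_range_normalOp (H : F.IsDiagonal h s) (i : Fin 2)
    {E : Module.End ℂ DiscreteFun} (hE : E ∈ (F.normalOp h).range) :
    opT i * E ∈ (F.normalOp h).range := by
  rw [H.opT_eq i, add_mul, smul_mul_assoc, smul_mul_assoc, smul_eq_mulHat_mul (F := F) (h := h),
    smul_eq_mulHat_mul (F := F) (h := h)]
  refine add_mem (mulHat_mul_mem_range_normalOp _ ?_) (mulHat_mul_mem_range_normalOp _ ?_)
  · refine mul_mem_range_normalOp
      (fun m a => ⟨Finsupp.single (m.1, m.2 + 1) (expScale s a), ?_⟩) hE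
    rw [normalOp_single, ← mul_assoc (F.glueOp h) (F.mulHat h a), H.glueOp_mul_mulHat, mul_assoc, ← mul_assoc (F.glueOp h),
      (show Commute (F.glueOp h) (F.crossOp h) from glueOp_mul_crossOp).pow_right m.1 |>.eq,
      mul_assoc, ← pow_succ']
  · refine mul_mem_range_normalOp
      (fun m a => ⟨Finsupp.single (m.1 + 1, m.2) (expScale s a), ?_⟩) hE
    rw [normalOp_single, ← mul_assoc (F.crossOp h) (F.mulHat h a), H.crossOp_mul_mulHat, mul_assoc, ← mul_assoc (F.crossOp h),
      ← pow_succ']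

/-- The normal forms contain 1 and are stable under left multiplication by the generators, because U
and V commute and both pass a coefficient f at the cost of X ↦ qX. -/
theorem IsDiagonal.mem_range_normalOp (H : F.IsDiagonal h s) {D : Module.End ℂ DiscreteFun}
    (hD : D ∈ F.T2 h) : D ∈ (F.normalOp h).range := by
  have key : ∀ E ∈ (F.normalOp h).range, D * E ∈ (F.normalOp h).range := by
    induction hD using Algebra.adjoin_induction with
    | mem D hD =>
      rcases hD with ⟨f, rfl⟩ | ⟨i, rfl⟩
      · exact fun E hE => mulHat_mul_mem_range_normalOp f hE
      · exact fun E hE => H.opT_mul_mem_range_normalOp i hE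
    | algebraMap c =>
      intro E hE
      rw [← F.mulHat_algebraMap h]
      exact mulHat_mul_mem_range_normalOp _ hE
    | add D D' _ _ hD hD' =>
      intro E hE
      rw [add_mul]
      exact add_mem (hD E hE) (hD' E hE)
    | mul D D' _ _ hD hD' =>
      intro E hE
      rw [mul_assoc]
      exact hD _ (hD' E hE)
  have h1 : (1 : Module.End ℂ DiscreteFun) ∈ (F.normalOp h).range := by
    refine ⟨Finsupp.single 0 1, ?_⟩
    rw [normalOp_single, ← map_one (algebraMap ℂ Coeff), mulHat_algebraMap]
    simp
  simpa using key 1 h1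

theorem val_smul (k : ℕ) (c : ℂ) (p : MvPolynomial Coord Coeff) :
    c • F.val h k p = F.val h k (MvPolynomial.C (algebraMap ℂ Coeff c) * p) := by
  rw [← mulHat_val, mulHat_algebraMap]
  rfl

theorem IsDiagonal.glueOp_val (H : F.IsDiagonal h s) (k : ℕ) (p : MvPolynomial Coord Coeff) :
    F.glueOp h (F.val h k p) = F.val h (k + 1)
      (glueForm (algebraMap ℂ Coeff F.B * algebraMap ℂ Coeff (Complex.exp s)) *
        MvPolynomial.map (expScale s) p) := by
  have hd := H.det_ne
  have h1 : ∀ i, opT i (F.val h k p) = F.gi h i 1 1 • F.val h (k + 1)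
      (glueForm (algebraMap ℂ Coeff F.B * algebraMap ℂ Coeff (Complex.exp s)) *
        MvPolynomial.map (expScale s) p) + F.gi h i 1 0 • F.val h (k + 1)
      (crossForm Coeff * MvPolynomial.map (expScale s) p) := by
    intro i
    rw [opT_val F h H.admissible, H.shift_single, H.formPoly_gi, val_smul, val_smul, ← val_add]
    congr 1
    ring
  simp only [glueOp, LinearMap.smul_apply, LinearMap.sub_apply, h1]
  rw [inv_smul_eq_iff₀ hd]
  module

theorem IsDiagonal.crossOp_val (H : F.IsDiagonal h s) (k : ℕ) (p : MvPolynomial Coord Coeff) :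
    F.crossOp h (F.val h k p) = F.val h (k + 1)
      (crossForm Coeff * MvPolynomial.map (expScale s) p) := by
  have hd := H.det_ne
  have h1 : ∀ i, opT i (F.val h k p) = F.gi h i 1 1 • F.val h (k + 1)
      (glueForm (algebraMap ℂ Coeff F.B * algebraMap ℂ Coeff (Complex.exp s)) *
        MvPolynomial.map (expScale s) p) + F.gi h i 1 0 • F.val h (k + 1)
      (crossForm Coeff * MvPolynomial.map (expScale s) p) := by
    intro i
    rw [opT_val F h H.admissible, H.shift_single, H.formPoly_gi, val_smul, val_smul, ← val_add]
    congr 1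
    ring
  simp only [crossOp, LinearMap.smul_apply, LinearMap.sub_apply, h1]
  rw [inv_smul_eq_iff₀ hd]
  module

theorem IsDiagonal.glueOp_pow_val (H : F.IsDiagonal h s) (b : Fin 2) (j : ℕ) :
    (F.glueOp h ^ j) (F.val h 1 (F.basisForm s b 0)) = F.val h (j + 1) (F.basisForm s b j *
      glueForm (algebraMap ℂ Coeff F.B * algebraMap ℂ Coeff (Complex.exp s)) ^ j) := by
  induction j with
  | zero => simp
  | succ j ih =>
    rw [pow_succ', Module.End.mul_apply, ih, H.glueOp_val, map_mul, map_pow, map_basisForm,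
      map_glueForm, map_mul, expScale_algebraMap, expScale_algebraMap]
    congr 1
    ring

/-- The forms c and v_{Bq} have constant coefficients and are fixed by the shift; only the basis
numerator records the i + j shifts. -/
theorem IsDiagonal.monomial_val (H : F.IsDiagonal h s) (b : Fin 2) (i j : ℕ) :
    (F.crossOp h ^ i * F.glueOp h ^ j) (F.val h 1 (F.basisForm s b 0)) =
      F.val h (i + j + 1) (F.basisForm s b (i + j) * (crossForm Coeff ^ i *
      glueForm (algebraMap ℂ Coeff F.B * algebraMap ℂ Coeff (Complex.exp s)) ^ j)) := by
  induction i with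
  | zero => simpa using H.glueOp_pow_val b j
  | succ i ih =>
    rw [pow_succ', mul_assoc, Module.End.mul_apply, ih, H.crossOp_val, map_mul, map_mul, map_pow,
      map_pow, map_basisForm, map_glueForm, map_mul, expScale_algebraMap, expScale_algebraMap,
      map_crossForm, show i + 1 + j = i + j + 1 by ring]
    congr 1
    ring

variable (F h s) in
/-- The products of `formFamily` for the data at hand. -/
def numerator (N : ℕ) (x : Fin 2 × ℕ × ℕ) : MvPolynomial Coord Coeff :=
  formFamily (algebraMap ℂ Coeff F.B) (algebraMap ℂ Coeff (Complex.exp s))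
    (algebraMap ℂ Coeff (F.g 1 1)) (algebraMap ℂ Coeff (F.g 1 0)) F.mult N x

theorem IsDiagonal.mulHat_mul_monomial_val (H : F.IsDiagonal h s) (a : Coeff) {N : ℕ}
    {x : Fin 2 × ℕ × ℕ} (hx : x.2 ∈ triangle N) :
    (F.mulHat h a * (F.crossOp h ^ x.2.1 * F.glueOp h ^ x.2.2))
      (F.val h 1 (F.basisForm s x.1 0)) = F.val h (N + 1) (a • F.numerator s N x) := by
  obtain ⟨b, i, j⟩ := x
  obtain ⟨l, hl⟩ := Nat.exists_eq_add_of_le (mem_triangle.1 hx)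
  have hij : N = i + j + l := hl
  -- Multiplying by gˡ, l = N - i - j, reaches the common denominator gᴺ⁺¹ and supplies the power of
  -- G in `formFamily`.
  rw [Module.End.mul_apply, H.monomial_val, ← F.val_raise h _ l, mulHat_val,
    MvPolynomial.smul_eq_C_mul, numerator, formFamily, formPoly_eq F.g_glue,
    show N - (b, i, j).2.1 - (b, i, j).2.2 = l by simp only; omega,
    show N + 1 = i + j + 1 + l by omega]
  congr 2
  simp only [basisForm]
  ring

theorem IsDiagonal.normalOp_val (H : F.IsDiagonal h s) (b : Fin 2) (f : (ℕ × ℕ) →₀ Coeff) {N : ℕ}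
    (hN : f.support ⊆ triangle N) :
    F.normalOp h f (F.val h 1 (F.basisForm s b 0)) =
      F.val h (N + 1) (∑ m ∈ triangle N, f m • F.numerator s N (b, m)) := by
  have h1 : F.normalOp h f = ∑ m ∈ triangle N,
      F.mulHat h (f m) * (F.crossOp h ^ m.1 * F.glueOp h ^ m.2) := by
    rw [normalOp, Finsupp.liftAddHom_apply, Finsupp.sum_of_support_subset _ hN]
    · rfl
    · intro m _
      exact AddMonoidHom.map_zero _
  rw [h1, LinearMap.sum_apply, val_sum]
  exact Finset.sum_congr rfl fun m hm => H.mulHat_mul_monomial_val (f m) (x := (b, m)) hm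

theorem mult_ne_zpow (F : OmegaData) (s : ℂ) (n : ℤ) :
    F.mult ≠ algebraMap ℂ Coeff F.B * algebraMap ℂ Coeff (Complex.exp s) ^ n := by
  rw [← map_zpow₀, ← map_mul]
  exact F.mult_ne _

theorem exists_support_subset_triangle (f : (ℕ × ℕ) →₀ Coeff) :
    ∃ N, ∀ N', N ≤ N' → f.support ⊆ triangle N' := by
  refine ⟨f.support.sup fun m => m.1 + m.2, fun N' hN m hm => mem_triangle.2 ?_⟩
  exact (Finset.le_sup (f := fun m : ℕ × ℕ => m.1 + m.2) hm).trans hN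

/-- In normal form, a relation between the two functions says that a combination of the products in
`formFamily` is zero; reading it at n = 0 already suffices. -/
theorem IsDiagonal.linearIndependent (H : F.IsDiagonal h s) :
    LinearIndependent (F.T2 h) fun b : Fin 2 => F.val h 1 (F.basisForm s b 0) := by
  refine (Fintype.linearIndependent_iff (ι := Fin 2) (R := F.T2 h)).2 ?_
  intro D hD
  choose f hf using fun b => H.mem_range_normalOp (D b).2
  choose M hM using fun b => exists_support_subset_triangle (f b)
  let N := M 0 + M 1
  have hN : ∀ b, (f b).support ⊆ triangle N := by
    intro b
    refine hM b N ?_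
    fin_cases b
    · exact Nat.le_add_right _ _
    · exact Nat.le_add_left _ _
  have h1 : ∀ b, D b • F.val h 1 (F.basisForm s b 0) =
      F.val h (N + 1) (∑ m ∈ triangle N, f b m • F.numerator s N (b, m)) := by
    intro b
    rw [← H.normalOp_val b (f b) (hN b), hf b]
    rfl
  simp only [h1] at hD
  rw [← val_sum] at hD
  have h2 := congrFun hD 0
  rw [val_apply_zero, Pi.zero_apply, div_eq_zero_iff, or_iff_left (pow_ne_zero _
    (formPoly_ne _ F.g_ne)), map_eq_zero_iff _ (IsFractionRing.injective _ ValueField)] at h2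
  have hB : algebraMap ℂ Coeff F.B ≠ 0 := (map_ne_zero _).2 F.B_ne
  have hq : algebraMap ℂ Coeff (Complex.exp s) ≠ 0 := (map_ne_zero _).2 (Complex.exp_ne_zero s)
  have hq1 : algebraMap ℂ Coeff (Complex.exp s) ≠ 1 := fun h0 => H.exp_ne_one
    ((algebraMap ℂ Coeff).injective (by rw [h0, map_one]))
  have hδ : algebraMap ℂ Coeff (F.g 1 1) ≠ 0 := (map_ne_zero _).2 (by
    have := F.g_ne
    rwa [evalForm_zero_one] at this)
  have h3 := eq_zero_of_sum_formFamily_eq_zero (γ := algebraMap ℂ Coeff (F.g 1 0)) hB hq hq1 hδ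
    (F.mult_ne_zpow s) N (fun x => f x.1 x.2) (by
      rw [Finset.sum_product]
      exact h2)
  intro b
  have h4 : f b = 0 := by
    ext1 m
    by_cases hm : m ∈ triangle N
    · exact h3 (b, m) (Finset.mem_product.2 ⟨Finset.mem_univ _, hm⟩)
    · exact Finsupp.notMem_support_iff.1 fun h0 => hm (hN b h0)
  ext1
  rw [← hf b, h4, map_zero]
  rfl

end OmegaData
-- Diagonal parameters: the basis lies in the first piece and generates.
namespace OmegaData

variable {F : OmegaData} {h : Fin 2 → ℂ} {s : ℂ}

theorem IsDiagonal.shift_mult (H : F.IsDiagonal h s) (n : Fin 2 → ℤ) :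
    F.shift h n F.mult =
      F.mult * (algebraMap ℂ Coeff (Complex.exp s ^ n 0 * Complex.exp s ^ n 1))⁻¹ := by
  rw [shift, expScale_mult]
  congr 3
  rw [← Complex.exp_int_mul, ← Complex.exp_int_mul, ← Complex.exp_add, Fin.sum_univ_two,
    ← H.ct_mul 0]
  congr 1
  have := (H.ct_mul 0).trans (H.ct_mul 1).symm
  linear_combination - (n 1 : ℂ) * this

theorem restrictFst_basisForm (b : Fin 2) (n : Fin 2 → ℤ) :
    restrictFst (MvPolynomial.map (F.shift h n) (F.basisForm s b 0)) =
      algebraMap Coeff LineField (F.shift h n F.mult) *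
        restrictSnd (MvPolynomial.map (F.shift h n) (F.basisForm s b 0)) := by
  fin_cases b
  · change restrictFst (MvPolynomial.map _ (crossForm Coeff)) = _ *
      restrictSnd (MvPolynomial.map _ (crossForm Coeff))
    rw [map_crossForm, restrictFst_crossForm, restrictSnd_crossForm, mul_zero]
  · change restrictFst (MvPolynomial.map _ (glueForm _)) = _ *
      restrictSnd (MvPolynomial.map _ (glueForm _))
    rw [map_glueForm, pow_zero, mul_one, restrictFst_glueForm]

theorem IsDiagonal.restrictFst_gi (H : F.IsDiagonal h s) (i : Fin 2) :
    restrictFst (formPoly Coeff (F.gi h i)) =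
      algebraMap Coeff LineField (algebraMap ℂ Coeff (F.B * Complex.exp s)) *
        restrictSnd (formPoly Coeff (F.gi h i)) := by
  apply restrictFst_formPoly
  have := F.G_glue i (F.ct i * h i)
  rw [H.ct_mul i] at this
  rw [gi, H.ct_mul i]
  exact this

/-- Between the curves each gⱼ/g gains the factor q, so the product gains q^(n₁+n₂); the shift by n
multiplies μ by q^(-n₁-n₂), and the two cancel. -/
theorem IsDiagonal.basis_mem_piece (H : F.IsDiagonal h s) (b : Fin 2) :
    F.val h 1 (F.basisForm s b 0) ∈ F.piece h 1 := by
  refine ⟨F.basisForm s b 0, ?_, fun n => rfl, fun n => ?_⟩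
  · fin_cases b
    · exact (crossForm_mem_gluedForms (1 : Coeff)).1
    · exact (glueForm_mem_gluedForms _).1
  · have hB : algebraMap Coeff LineField (algebraMap ℂ Coeff F.B) ≠ 0 := by simp [F.B_ne]
    have hq : algebraMap Coeff LineField (algebraMap ℂ Coeff (Complex.exp s)) ≠ 0 := by
      simp
    have hG := restrictSnd_ne _ F.g_ne
    have key : ∀ R : LineField, algebraMap Coeff LineField (algebraMap ℂ Coeff F.B) *
        algebraMap Coeff LineField (algebraMap ℂ Coeff (Complex.exp s)) * R /
        (algebraMap Coeff LineField (algebraMap ℂ Coeff F.B) *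
        restrictSnd (formPoly Coeff F.g)) =
        algebraMap Coeff LineField (algebraMap ℂ Coeff (Complex.exp s)) *
          (R / restrictSnd (formPoly Coeff F.g)) := by
      intro R
      field_simp
    simp only [value, restrictFst_basisForm, H.restrictFst_gi, restrictFst_formPoly F.g_glue,
      multiplier, Fin.prod_univ_two, H.shift_mult, pow_one]
    simp only [mult, map_mul, key, mul_zpow, map_inv₀, map_zpow₀]
    set q := algebraMap Coeff LineField (algebraMap ℂ Coeff (Complex.exp s))
    have h0 := zpow_ne_zero (n 0) hq
    have h1 := zpow_ne_zero (n 1) hq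
    rw [← RatFunc.algebraMap_eq_C]
    field_simp

theorem IsDiagonal.mem_span_of_mem_piece (H : F.IsDiagonal h s) {k : ℕ} {ψ : DiscreteFun}
    (hψ : ψ ∈ F.piece h k) : ψ ∈ Submodule.span (F.T2 h)
      (Set.range fun b : Fin 2 => F.val h 1 (F.basisForm s b 0)) := by
  -- Raising by one makes the bidegree positive, as the spanning result for (N+1, N+1) requires.
  obtain ⟨p, hp, h1, h2⟩ := F.piece_raise h 1 hψ
  have hp' := F.mem_gluedForms_of_value h hp (h2 0)
  rw [← F.mult_mul_pow] at hp'
  have hB : algebraMap ℂ Coeff F.B ≠ 0 := (map_ne_zero _).2 F.B_ne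
  have hq : algebraMap ℂ Coeff (Complex.exp s) ≠ 0 := (map_ne_zero _).2 (Complex.exp_ne_zero s)
  have hq1 : algebraMap ℂ Coeff (Complex.exp s) ≠ 1 := fun h0 => H.exp_ne_one
    ((algebraMap ℂ Coeff).injective (by rw [h0, map_one]))
  have hδ : algebraMap ℂ Coeff (F.g 1 1) ≠ 0 := (map_ne_zero _).2 (by
    have := F.g_ne
    rwa [evalForm_zero_one] at this)
  obtain ⟨a, ha⟩ := exists_eq_sum_formFamily (γ := algebraMap ℂ Coeff (F.g 1 0)) hB hq hq1 hδ
    (F.mult_ne_zpow s) k hp'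
  have h3 : ψ = ∑ x ∈ Finset.univ ×ˢ triangle k, F.val h (k + 1) (a x • F.numerator s k x) := by
    rw [← val_sum]
    funext n
    rw [h1 n]
    simp only [numerator]
    rw [ha]
    rfl
  rw [h3]
  refine Submodule.sum_mem _ fun x hx => ?_
  rw [← H.mulHat_mul_monomial_val (a x) (Finset.mem_product.1 hx).2]
  exact Submodule.smul_mem _ (⟨_, (F.T2 h).mul_mem (mulHat_mem (a x)) ((F.T2 h).mul_mem
    ((F.T2 h).pow_mem crossOp_mem x.2.1) ((F.T2 h).pow_mem glueOp_mem x.2.2))⟩ : F.T2 h)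
    (Submodule.subset_span ⟨x.1, rfl⟩)

theorem IsDiagonal.mem_freeParameters (H : F.IsDiagonal h s) : h ∈ F.freeParameters := by
  refine ⟨H.admissible, fun b => F.val h 1 (F.basisForm s b 0), H.basis_mem_piece,
    H.linearIndependent, le_antisymm (Submodule.span_le.2 ?_) ?_⟩
  · rintro _ ⟨b, rfl⟩
    exact ⟨1, H.basis_mem_piece b⟩
  · rintro ψ ⟨k, hk⟩
    exact H.mem_span_of_mem_piece hk

/-! ### Uncountably many diagonal parameters. -/

open Filter Topology

variable (F)

theorem G_zero_one (i : Fin 2) (s : ℂ) : F.G i s 0 1 = F.B * Complex.exp s * F.G i s 1 1 := by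
  simpa [evalForm] using F.G_glue i s ![0, 1]

theorem G_zero_zero (i : Fin 2) (s : ℂ) : F.G i s 0 0 = F.B * Complex.exp s * F.G i s 0 1 := by
  simpa [evalForm] using F.G_glue i s ![1, 0]

theorem hasDerivAt_G (i a b : Fin 2) :
    HasDerivAt (fun s => F.G i s a b) (deriv (F.G i) 0 a b) 0 :=
  hasDerivAt_pi.1 (hasDerivAt_pi.1 (F.G_analytic i).differentiableAt.hasDerivAt a) b

theorem deriv_G_zero_one (i : Fin 2) :
    deriv (F.G i) 0 0 1 = F.B * F.g 1 1 + F.B * deriv (F.G i) 0 1 1 := by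
  have h1 := F.hasDerivAt_G i 0 1
  simp only [F.G_zero_one i] at h1
  have h2 := ((Complex.hasDerivAt_exp 0).const_mul F.B).mul (F.hasDerivAt_G i 1 1)
  have := h1.unique h2
  simpa [F.G_zero i] using this

theorem deriv_G_zero_zero (i : Fin 2) :
    deriv (F.G i) 0 0 0 = F.B * F.g 0 1 + F.B * deriv (F.G i) 0 0 1 := by
  have h1 := F.hasDerivAt_G i 0 0
  simp only [F.G_zero_zero i] at h1
  have h2 := ((Complex.hasDerivAt_exp 0).const_mul F.B).mul (F.hasDerivAt_G i 0 1)
  have := h1.unique h2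
  simpa [F.G_zero i] using this

/-- This is the derivative at s = 0 of the determinant of (G₁, G₂). The entries in row 0 of ∂Gᵢ
follow from g and the (1, 1) entry by differentiating the gluing relations, so its vanishing would
give a linear relation among g, ∂G₁, ∂G₂. -/
theorem deriv_det_ne : deriv (F.G 0) 0 1 1 * F.g 1 0 + F.g 1 1 * deriv (F.G 1) 0 1 0 -
    (deriv (F.G 1) 0 1 1 * F.g 1 0 + F.g 1 1 * deriv (F.G 0) 0 1 0) ≠ 0 := by
  intro h0
  have hδ : F.g 1 1 ≠ 0 := by
    have := F.g_ne
    rwa [evalForm_zero_one] at this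
  have h1 := Fintype.linearIndependent_iff.1 F.G_indep
    -- These coefficients cancel the (1, 1) entry; the inhomogeneous terms in row 0 cancel in ∂G₁ -
    -- ∂G₂.
    ![-(deriv (F.G 0) 0 1 1 - deriv (F.G 1) 0 1 1), F.g 1 1, - F.g 1 1] (by
      have e01 : F.g 0 1 = F.B * F.g 1 1 := by simpa [evalForm] using F.g_glue ![0, 1]
      have e00 : F.g 0 0 = F.B * F.g 0 1 := by simpa [evalForm] using F.g_glue ![1, 0]
      rw [Fin.sum_univ_three]
      ext i j
      fin_cases i <;> fin_cases j <;>
        simp [deriv_G_zero_zero, deriv_G_zero_one, e00, e01] <;>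
        first | ring1 | linear_combination -h0) 1
  exact hδ (by simpa using h1)

theorem eventually_isDiagonal :
    ∀ᶠ s in 𝓝[≠] (0 : ℂ), F.IsDiagonal (fun i => s / F.ct i) s := by
  have hδ : F.g 1 1 ≠ 0 := by
    have := F.g_ne
    rwa [evalForm_zero_one] at this
  have hgi : ∀ s i, F.gi (fun i => s / F.ct i) i = F.G i s := fun s i => by
    rw [gi, mul_div_cancel₀ _ (F.ct_ne i)]
  have h1 : ∀ᶠ s in 𝓝[≠] (0 : ℂ), Complex.exp s ≠ 1 :=
    (Complex.hasDerivAt_exp 0).eventually_ne (Complex.exp_ne_zero 0)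
  have h2 : ∀ i, ∀ᶠ s in 𝓝[≠] (0 : ℂ), F.G i s 1 1 ≠ 0 := fun i =>
    ((F.hasDerivAt_G i 1 1).continuousAt.eventually_ne (by rwa [F.G_zero i])).filter_mono
      nhdsWithin_le_nhds
  -- At s = 0 both forms equal g and the determinant is zero, so its nonzero derivative has to be
  -- used.
  have h3 : ∀ᶠ s in 𝓝[≠] (0 : ℂ),
      F.G 0 s 1 1 * F.G 1 s 1 0 - F.G 1 s 1 1 * F.G 0 s 1 0 ≠ 0 := by
    refine (((F.hasDerivAt_G 0 1 1).mul (F.hasDerivAt_G 1 1 0)).sub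
      ((F.hasDerivAt_G 1 1 1).mul (F.hasDerivAt_G 0 1 0))).eventually_ne ?_
    rw [F.G_zero, F.G_zero]
    exact F.deriv_det_ne
  filter_upwards [h1, h2 0, h2 1, h3] with s h1 h20 h21 h3
  refine ⟨fun i => mul_div_cancel₀ _ (F.ct_ne i), h1, fun i => ?_, ?_⟩
  · rw [hgi]
    fin_cases i
    · exact h20
    · exact h21
  · simpa only [hgi] using h3

/-- Together with 0, the preimage of the free parameters under s ↦ (s/c̃₁, s/c̃₂) is a neighbourhood
of 0, whereas a countable subset of ℂ has empty interior. -/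
theorem not_countable_freeParameters : ¬ F.freeParameters.Countable := by
  intro hc
  have hinj : Function.Injective fun (s : ℂ) (i : Fin 2) => s / F.ct i := by
    intro s t hst
    exact (div_left_inj' (F.ct_ne 0)).1 (congrFun hst 0)
  have h1 := hc.preimage hinj
  have h2 := (h1.insert 0).dense_compl ℂ
  rw [← interior_eq_empty_iff_dense_compl] at h2
  have h3 : insert 0 ((fun (s : ℂ) (i : Fin 2) => s / F.ct i) ⁻¹' F.freeParameters) ∈ 𝓝 (0 : ℂ) := by
    rw [insert_mem_nhds_iff]
    filter_upwards [F.eventually_isDiagonal] with s hs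
    exact hs.mem_freeParameters
  have h4 := mem_interior_iff_mem_nhds.2 h3
  rw [h2] at h4
  exact h4

end OmegaData

/-! ### Elements of A as glued fractions p/gᴺ. -/

theorem eval_formPoly (a : Fin 2 → Fin 2 → ℂ) (z w : Fin 2 → ℂ) :
    MvPolynomial.eval (Sum.elim z w) (formPoly ℂ a) = evalForm a z w := by
  simp [formPoly, evalForm]

theorem formPoly_complex_bihomogeneous (a : Fin 2 → Fin 2 → ℂ) :
    IsBihomogeneous (formPoly ℂ a) 1 := by
  simp only [formPoly, Fin.sum_univ_two]
  exact ((isBihomogeneous_monomial _ 0 0).add (isBihomogeneous_monomial _ 0 1)).add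
    ((isBihomogeneous_monomial _ 1 0).add (isBihomogeneous_monomial _ 1 1))

theorem formPoly_complex_ne {a : Fin 2 → Fin 2 → ℂ} {z w : Fin 2 → ℂ} (h : evalForm a z w ≠ 0) :
    formPoly ℂ a ≠ 0 := by
  intro h0
  rw [← eval_formPoly, h0, map_zero] at h
  exact h rfl

theorem ne_zero_of_evalForm_ne_zero {a : Fin 2 → Fin 2 → ℂ} {z w : Fin 2 → ℂ}
    (h : evalForm a z w ≠ 0) : z ≠ 0 ∧ w ≠ 0 := by
  constructor
  · rintro rfl; simp [evalForm] at h
  · rintro rfl; simp [evalForm] at h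

-- The component of p of bidegree (k, k) times q is the component of pq of bidegree (k+l, k+l), that
-- is, pq itself; then q cancels.
attribute [local instance] MvPolynomial.weightedGradedAlgebra in
theorem IsBihomogeneous.of_mul_right {R : Type*} [CommRing R] [IsDomain R]
    {p q : MvPolynomial Coord R} {k l : ℕ} (hq : IsBihomogeneous q l) (hq0 : q ≠ 0)
    (hpq : IsBihomogeneous (p * q) (k + l)) : IsBihomogeneous p k := by
  have h1 := DirectSum.coe_decompose_mul_add_of_right_mem
    (𝒜 := MvPolynomial.weightedHomogeneousSubmodule R
      (Sum.elim (fun _ => (1, 0)) (fun _ => (0, 1)) : Coord → ℕ × ℕ)) (i := (k, k)) (a := p) hq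
  have h2 := DirectSum.decompose_of_mem_same (ℳ := MvPolynomial.weightedHomogeneousSubmodule R
      (Sum.elim (fun _ => (1, 0)) (fun _ => (0, 1)) : Coord → ℕ × ℕ)) hpq
  have h3 := mul_right_cancel₀ hq0 (h1.symm.trans h2)
  rw [← h3]
  exact (DirectSum.decompose (MvPolynomial.weightedHomogeneousSubmodule R
    (Sum.elim (fun _ => (1, 0)) (fun _ => (0, 1)) : Coord → ℕ × ℕ)) p (k, k)).2

variable {F : OmegaData}

/-- Let r = a/b be reduced. Where g ≠ 0, a local denominator of r is nonzero and divisible by b, so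
b ≠ 0 there. Thus g vanishes on the zero set of b, and the Nullstellensatz gives b ∣ gᴺ. -/
theorem exists_eq_div_pow {g : Fin 2 → Fin 2 → ℂ} (hg : evalForm g ![0, 1] ![0, 1] ≠ 0)
    {r : RatFun ℂ} (hr : r ∈ ringA g) : ∃ (N : ℕ) (p : MvPolynomial Coord ℂ),
      IsBihomogeneous p N ∧ r = algebraMap _ (RatFun ℂ) p / algebraMap _ (RatFun ℂ) (formPoly ℂ g) ^ N := by
  obtain ⟨φ, hφ⟩ := hr
  set a := IsFractionRing.num (MvPolynomial Coord ℂ) r with ha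
  set b : MvPolynomial Coord ℂ := (IsFractionRing.den (MvPolynomial Coord ℂ) r).1 with hb
  have hab : algebraMap _ (RatFun ℂ) a / algebraMap _ (RatFun ℂ) b = r := by
    have := IsFractionRing.mk'_num_den' (MvPolynomial Coord ℂ) r
    exact this
  have hb0 : algebraMap _ (RatFun ℂ) b ≠ 0 := by
    rw [map_ne_zero_iff _ (IsFractionRing.injective _ (RatFun ℂ))]
    exact nonZeroDivisors.coe_ne_zero _
  have hvan : formPoly ℂ g ∈ MvPolynomial.vanishingIdeal ℂ
      (MvPolynomial.zeroLocus ℂ (Ideal.span {b})) := by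
    rw [MvPolynomial.mem_vanishingIdeal_iff]
    intro x hx
    by_contra hne
    have hxb : MvPolynomial.eval x b = 0 := by
      have := hx b (Ideal.mem_span_singleton_self b)
      simpa [MvPolynomial.aeval_eq_eval] using this
    have hx' : evalForm g (x ∘ Sum.inl) (x ∘ Sum.inr) ≠ 0 := by
      rw [← eval_formPoly, Sum.elim_comp_inl_inr]
      simpa [MvPolynomial.aeval_eq_eval] using hne
    obtain ⟨hz, hw⟩ := ne_zero_of_evalForm_ne_zero hx'
    obtain ⟨k, p, q, -, -, hq0, hpq, -⟩ := hφ _ _ hz hw hx'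
    have hq0' := algebraMap_ne_zero_of_eval hq0
    rw [← hab, div_eq_div_iff hb0 hq0', ← map_mul, ← map_mul] at hpq
    have h1 := IsFractionRing.injective _ (RatFun ℂ) hpq
    have h2 : b ∣ q := (IsFractionRing.num_den_reduced (MvPolynomial Coord ℂ) r).symm.dvd_of_dvd_mul_left
      ⟨p, by rw [← ha, h1, mul_comm]⟩
    obtain ⟨c, rfl⟩ := h2
    rw [Sum.elim_comp_inl_inr, map_mul, hxb, zero_mul] at hq0
    exact hq0 rfl
  rw [MvPolynomial.vanishingIdeal_zeroLocus_eq_radical] at hvan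
  obtain ⟨N, hN⟩ := hvan
  obtain ⟨c, hc⟩ := Ideal.mem_span_singleton.1 hN
  have hg0 : algebraMap _ (RatFun ℂ) (formPoly ℂ g) ≠ 0 := by
    rw [map_ne_zero_iff _ (IsFractionRing.injective _ (RatFun ℂ))]
    exact formPoly_complex_ne hg
  have hr' : r = algebraMap _ (RatFun ℂ) (a * c) / algebraMap _ (RatFun ℂ) (formPoly ℂ g) ^ N := by
    have hc0 : algebraMap _ (RatFun ℂ) c ≠ 0 := by
      intro h0
      have := congrArg (algebraMap _ (RatFun ℂ)) hc
      rw [map_pow, map_mul, h0, mul_zero] at this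
      exact pow_ne_zero N hg0 this
    rw [← map_pow, hc, map_mul, map_mul, mul_div_mul_right _ _ hc0, hab]
  refine ⟨N, a * c, ?_, hr'⟩
  obtain ⟨hz, hw⟩ := ne_zero_of_evalForm_ne_zero hg
  obtain ⟨k, p, q, hp, hq, hq0, hpq, -⟩ := hφ _ _ hz hw hg
  -- Bihomogeneity is inherited from a single local representation p/q, through acq = pgᴺ.
  refine IsBihomogeneous.of_mul_right hq (fun h0 => by simp [h0] at hq0) (p := a * c) ?_
  have h1 : a * c * q = p * formPoly ℂ g ^ N := by
    apply IsFractionRing.injective _ (RatFun ℂ)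
    rw [hr', div_eq_div_iff (pow_ne_zero _ hg0) (algebraMap_ne_zero_of_eval hq0), ← map_pow,
      ← map_mul, ← map_mul] at hpq
    exact hpq
  rw [h1, add_comm N k]
  have h2 : IsBihomogeneous (formPoly ℂ g ^ N) N := by
    simpa [IsBihomogeneous] using (formPoly_complex_bihomogeneous g).pow N
  exact hp.mul h2

theorem RegularWithValue.eq_div {g : Fin 2 → Fin 2 → ℂ} {r : RatFun ℂ} {z w : Fin 2 → ℂ} {v : ℂ}
    (h : RegularWithValue r z w v) (hg : evalForm g z w ≠ 0) {N : ℕ} {p : MvPolynomial Coord ℂ}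
    (hr : r = algebraMap _ (RatFun ℂ) p / algebraMap _ (RatFun ℂ) (formPoly ℂ g) ^ N) :
    v = MvPolynomial.eval (Sum.elim z w) p / evalForm g z w ^ N := by
  obtain ⟨k, p', q, -, -, hq, hr', rfl⟩ := h
  have hg0 : algebraMap _ (RatFun ℂ) (formPoly ℂ g) ≠ 0 := by
    rw [map_ne_zero_iff _ (IsFractionRing.injective _ (RatFun ℂ))]
    exact formPoly_complex_ne hg
  rw [hr, div_eq_div_iff (pow_ne_zero _ hg0) (algebraMap_ne_zero_of_eval hq), ← map_pow,
    ← map_mul, ← map_mul] at hr'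
  have h1 := congrArg (MvPolynomial.eval (Sum.elim z w)) (IsFractionRing.injective _ (RatFun ℂ) hr')
  rw [map_mul, map_mul, map_pow, eval_formPoly] at h1
  rw [div_eq_div_iff hq (pow_ne_zero _ hg), h1]

theorem Omega.mk_eq_mk {t : Fin 2 → ℂ} (ht : t ≠ 0) (h10 : (![1, 0] : Fin 2 → ℂ) ≠ 0)
    (h01 : (![0, 1] : Fin 2 → ℂ) ≠ 0) : Omega.mk ![1, 0] t h10 ht = Omega.mk t ![0, 1] ht h01 :=
  Quot.sound ⟨Projectivization.mk ℂ t ht, rfl, rfl⟩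

theorem aeval_fst_eq {r : RatFun ℂ} (hr : r ∈ ringA F.g) {N : ℕ} {p : MvPolynomial Coord ℂ}
    (hp : r = algebraMap _ (RatFun ℂ) p / algebraMap _ (RatFun ℂ) (formPoly ℂ F.g) ^ N) :
    MvPolynomial.aeval (Sum.elim ![1, 0] MvPolynomial.X : Coord → MvPolynomial (Fin 2) ℂ) p =
      MvPolynomial.C (F.B ^ N) * MvPolynomial.aeval (Sum.elim MvPolynomial.X ![0, 1]) p := by
  obtain ⟨φ, hφ⟩ := hr
  let e : MvPolynomial (Fin 2) ℂ :=
    MvPolynomial.aeval (Sum.elim MvPolynomial.X ![0, 1]) (formPoly ℂ F.g)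
  have he : e ≠ 0 := by
    intro h0
    have := congrArg (MvPolynomial.eval ![0, 1]) h0
    rw [eval_aeval_snd, eval_formPoly, map_zero] at this
    exact F.g_ne this
  -- The extra factor g(t, 0, 1) makes the identity trivial at points of the pole curve, where the
  -- function on Ω gives no information.
  refine mul_right_cancel₀ he (MvPolynomial.funext fun t => ?_)
  rw [map_mul, map_mul, map_mul, eval_aeval_fst, eval_aeval_snd, eval_aeval_snd, eval_formPoly,
    MvPolynomial.eval_C]
  by_cases h0 : evalForm F.g t ![0, 1] = 0
  · rw [h0, mul_zero, mul_zero]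
  · have h1 : evalForm F.g ![1, 0] t ≠ 0 := by
      rw [F.g_glue]
      exact mul_ne_zero F.B_ne h0
    obtain ⟨ht, h01⟩ := ne_zero_of_evalForm_ne_zero h0
    obtain ⟨h10, -⟩ := ne_zero_of_evalForm_ne_zero h1
    have h2 := (hφ _ _ h10 ht h1).eq_div h1 hp
    have h3 := (hφ _ _ ht h01 h0).eq_div h0 hp
    rw [Omega.mk_eq_mk ht h10 h01, h3, F.g_glue, mul_pow,
      div_eq_div_iff (pow_ne_zero _ h0) (mul_ne_zero (pow_ne_zero _ F.B_ne) (pow_ne_zero _ h0)),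
      ← mul_assoc] at h2
    have h4 := mul_right_cancel₀ (pow_ne_zero _ h0) h2
    rw [← h4]
    ring

section ExtendCoeff

variable (p : MvPolynomial Coord ℂ)

theorem restrictFst_map : restrictFst (MvPolynomial.map (algebraMap ℂ Coeff) p) =
    algebraMap (MvPolynomial (Fin 2) Coeff) LineField (MvPolynomial.map (algebraMap ℂ Coeff)
      (MvPolynomial.aeval (Sum.elim ![1, 0] MvPolynomial.X) p)) := by
  rw [restrictFst, RingHom.comp_apply]
  congr 1
  change MvPolynomial.aeval _ (MvPolynomial.map _ p) = _
  induction p using MvPolynomial.induction_on with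
  | C a => simp [MvPolynomial.algebraMap_eq]
  | add p q hp hq => simp only [map_add, hp, hq]
  | mul_X p i hp =>
    simp only [map_mul, hp, MvPolynomial.map_X, MvPolynomial.aeval_X]
    congr 1
    rcases i with i | i
    · fin_cases i <;> simp
    · simp

theorem restrictSnd_map : restrictSnd (MvPolynomial.map (algebraMap ℂ Coeff) p) =
    algebraMap (MvPolynomial (Fin 2) Coeff) LineField (MvPolynomial.map (algebraMap ℂ Coeff)
      (MvPolynomial.aeval (Sum.elim MvPolynomial.X ![0, 1]) p)) := by
  rw [restrictSnd, RingHom.comp_apply]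
  congr 1
  change MvPolynomial.aeval _ (MvPolynomial.map _ p) = _
  induction p using MvPolynomial.induction_on with
  | C a => simp [MvPolynomial.algebraMap_eq]
  | add p q hp hq => simp only [map_add, hp, hq]
  | mul_X p i hp =>
    simp only [map_mul, hp, MvPolynomial.map_X, MvPolynomial.aeval_X]
    congr 1
    rcases i with i | i
    · simp
    · fin_cases i <;> simp

theorem map_formPoly_complex (a : Fin 2 → Fin 2 → ℂ) :
    MvPolynomial.map (algebraMap ℂ Coeff) (formPoly ℂ a) = formPoly Coeff a := by
  simp [formPoly]

theorem extendCoeff_algebraMap : extendCoeff (algebraMap _ (RatFun ℂ) p) =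
    algebraMap _ ValueField (MvPolynomial.map (algebraMap ℂ Coeff) p) := by
  rw [extendCoeff, IsFractionRing.map]
  exact IsLocalization.map_eq _ _

end ExtendCoeff

/-! ### Multiplication by A on the module, and the embedding into matrices. -/

namespace OmegaData

variable (F) (h : Fin 2 → ℂ)

theorem shift_comp_algebraMap (n : Fin 2 → ℤ) :
    (F.shift h n).comp (algebraMap ℂ Coeff) = algebraMap ℂ Coeff :=
  RingHom.ext fun c => expScale_algebraMap _ c

theorem value_mul_map {L : Type} [Field L] (ρ : MvPolynomial Coord Coeff →+* L) (N k : ℕ)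
    (p : MvPolynomial Coord ℂ) (q : MvPolynomial Coord Coeff) (n : Fin 2 → ℤ) :
    F.value h ρ (N + k) (MvPolynomial.map (algebraMap ℂ Coeff) p * q) n =
      ρ (MvPolynomial.map (algebraMap ℂ Coeff) p) / ρ (formPoly Coeff F.g) ^ N *
        F.value h ρ k q n := by
  simp only [value, map_mul, MvPolynomial.map_map, shift_comp_algebraMap, pow_add]
  rw [mul_div_mul_comm, mul_assoc]

/-- Numerator and denominator of r = p/gᴺ both gain Bᴺ between the curves, so r has equal
restrictions there and leaves the multiplier of ψ unchanged. -/
theorem extendCoeff_mul_mem_baModule (hadm : F.Admissible h) {r : RatFun ℂ} (hr : r ∈ ringA F.g)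
    {ψ : DiscreteFun} (hψ : ψ ∈ F.baModule h hadm) :
    (fun n => extendCoeff r * ψ n) ∈ F.baModule h hadm := by
  obtain ⟨N, p, hp, hrp⟩ := exists_eq_div_pow F.g_ne hr
  have hglue := aeval_fst_eq hr hrp
  obtain ⟨k, q, hq, h1, h2⟩ := hψ
  refine ⟨N + k, MvPolynomial.map (algebraMap ℂ Coeff) p * q, ?_, fun n => ?_, fun n => ?_⟩
  · refine MvPolynomial.IsWeightedHomogeneous.mul (m := (N, N)) (n := (k, k)) (fun d hd => hp ?_) hq
    intro h0
    exact hd (by rw [MvPolynomial.coeff_map, h0, map_zero])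
  · rw [value_mul_map, ← h1, hrp, map_div₀, map_pow, extendCoeff_algebraMap,
      extendCoeff_algebraMap, map_formPoly_complex]
  · rw [value_mul_map, value_mul_map, h2, restrictFst_map, restrictSnd_map, hglue,
      restrictFst_formPoly F.g_glue, mul_pow, map_mul, map_mul, MvPolynomial.map_C,
      ← MvPolynomial.algebraMap_eq, ← IsScalarTower.algebraMap_apply, map_pow, map_pow,
      mul_div_mul_left]
    · ring
    · exact pow_ne_zero _ (by simp [F.B_ne])

theorem apply_mul_const {D : Module.End ℂ DiscreteFun} (hD : D ∈ F.T2 h) (c : ValueField) :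
    ∀ ψ : DiscreteFun, D (fun n => c * ψ n) = fun n => c * D ψ n := by
  induction hD using Algebra.adjoin_induction with
  | mem D hD =>
    intro ψ
    rcases hD with ⟨f, rfl⟩ | ⟨i, rfl⟩
    · funext n
      exact mul_left_comm _ _ _
    · rfl
  | algebraMap a =>
    intro ψ
    funext n
    exact (mul_smul_comm a c (ψ n)).symm
  | add D E _ _ hD hE =>
    intro ψ
    funext n
    rw [LinearMap.add_apply, LinearMap.add_apply, hD, hE, Pi.add_apply, Pi.add_apply, mul_add]
  | mul D E _ _ hD hE =>
    intro ψ
    rw [Module.End.mul_apply, hE, hD]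
    rfl

/-- Spanning gives the rows of D(r), and independence makes them unique, so each algebra identity
may be checked on the basis. For products, D(r)D(t)Ψ = D(r)(tΨ) = t D(r)Ψ = rtΨ by
`apply_mul_const`. Injectivity holds because ψ₁ has a nonzero value in a field. -/
theorem exists_algHom_of_isBasis (hadm : F.Admissible h) {ψ : Fin 2 → DiscreteFun}
    (hψ : F.IsBasis h hadm ψ) :
    ∃ D : ringA F.g →ₐ[ℂ] Matrix (Fin 2) (Fin 2) (F.T2 h), Function.Injective D ∧
      ∀ (r : ringA F.g) (i : Fin 2) (n : Fin 2 → ℤ),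
        (∑ j, D r i j • ψ j) n = extendCoeff r * ψ i n := by
  obtain ⟨hli, hspan⟩ := hψ
  have huniq : ∀ M M' : Matrix (Fin 2) (Fin 2) (F.T2 h),
      (∀ i, ∑ j, M i j • ψ j = ∑ j, M' i j • ψ j) → M = M' := by
    intro M M' hM
    ext1 i j
    exact Fintype.linearIndependent_iffₛ.1 hli _ _ (hM i) j
  have hex : ∀ (r : ringA F.g) (i : Fin 2), ∃ c : Fin 2 → F.T2 h,
      ∑ j, c j • ψ j = fun n => extendCoeff r * ψ i n := by
    intro r i
    rw [← Submodule.mem_span_range_iff_exists_fun, hspan]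
    refine F.extendCoeff_mul_mem_baModule h hadm r.2 ?_
    rw [← hspan]
    exact Submodule.subset_span ⟨i, rfl⟩
  choose D hD using hex
  have hcomm : ∀ (E : F.T2 h) (c : ValueField) (χ : DiscreteFun),
      E • (fun n => c * χ n) = fun n => c * (E • χ) n := fun E c χ =>
    F.apply_mul_const h E.2 c χ
  have hmulD : ∀ (M N : Matrix (Fin 2) (Fin 2) (F.T2 h)) (i : Fin 2),
      ∑ j, (M * N) i j • ψ j = ∑ l, M i l • ∑ j, N l j • ψ j := by
    intro M N i
    simp only [Matrix.mul_apply, Finset.sum_smul, Finset.smul_sum, mul_smul]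
    exact Finset.sum_comm
  have hscal : ∀ (c : ℂ) (i : Fin 2),
      ∑ j, algebraMap ℂ (Matrix (Fin 2) (Fin 2) (F.T2 h)) c i j • ψ j = c • ψ i := by
    intro c i
    rw [Finset.sum_eq_single i]
    · rw [Matrix.algebraMap_matrix_apply, if_pos rfl]
      rfl
    · intro j _ hj
      rw [Matrix.algebraMap_matrix_apply, if_neg hj.symm]
      exact zero_smul (F.T2 h) (ψ j)
    · exact fun h0 => absurd (Finset.mem_univ i) h0
  let M : ringA F.g → Matrix (Fin 2) (Fin 2) (F.T2 h) := D
  have hM : ∀ r i, ∑ j, M r i j • ψ j = fun n => extendCoeff r * ψ i n := hD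
  have hMc : ∀ c : ℂ, M (algebraMap ℂ (ringA F.g) c) = algebraMap ℂ _ c := by
    intro c
    refine huniq _ _ fun i => ?_
    rw [hM, hscal]
    funext n
    change extendCoeff (algebraMap ℂ (RatFun ℂ) c) * ψ i n = c • ψ i n
    rw [IsScalarTower.algebraMap_apply ℂ (MvPolynomial Coord ℂ) (RatFun ℂ), extendCoeff_algebraMap,
      Algebra.smul_def, IsScalarTower.algebraMap_apply ℂ Coeff ValueField,
      IsScalarTower.algebraMap_apply Coeff (MvPolynomial Coord Coeff) ValueField,
      MvPolynomial.algebraMap_eq, MvPolynomial.algebraMap_eq, MvPolynomial.map_C]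
  refine ⟨
    { toFun := M
      map_one' := ?_
      map_mul' := ?_
      map_zero' := ?_
      map_add' := ?_
      commutes' := hMc }, ?_, fun r i n => congrFun (hM r i) n⟩
  · simpa using hMc 1
  · intro r t
    refine huniq _ _ fun i => ?_
    rw [hmulD, hM]
    simp only [hM, hcomm]
    funext n
    rw [Finset.sum_apply, ← Finset.mul_sum, ← Finset.sum_apply n Finset.univ fun j => M r i j • ψ j,
      hM, Subalgebra.coe_mul, map_mul]
    ring
  · simpa using hMc 0
  · intro r t
    refine huniq _ _ fun i => ?_
    simp only [Matrix.add_apply, add_smul, Finset.sum_add_distrib, hM]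
    funext n
    rw [Subalgebra.coe_add, map_add, add_mul]
    rfl
  · intro r t hrt
    have h0 : M r = M t := hrt
    have hne : ψ 0 ≠ 0 := hli.ne_zero 0
    obtain ⟨n, hn⟩ := Function.ne_iff.1 hne
    have h1 : extendCoeff r * ψ 0 n = extendCoeff t * ψ 0 n := by
      rw [← congrFun (hM r 0) n, ← congrFun (hM t 0) n, h0]
    exact Subtype.ext (extendCoeff.injective (mul_right_cancel₀ hn h1))

end OmegaData
end
end DBA

theorem mainTheorem7 (F : DBA.OmegaData) :
    ¬ F.freeParameters.Countable ∧
    ∀ h ∈ F.freeParameters, ∀ (hadm : F.Admissible h) (ψ : Fin 2 → DBA.DiscreteFun),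
      F.IsBasis h hadm ψ →
      ∃ D : DBA.ringA F.g →ₐ[ℂ] Matrix (Fin 2) (Fin 2) (F.T2 h),
        Function.Injective D ∧
        ∀ (r : DBA.ringA F.g) (i : Fin 2) (n : Fin 2 → ℤ),
          (∑ j, D r i j • ψ j) n = DBA.extendCoeff r * ψ i n := by
  exact ⟨F.not_countable_freeParameters, fun h _ hadm _ hψ => F.exists_algHom_of_isBasis h hadm hψ⟩
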